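/- Let $s \ge 2$ be an integer. Then the complete graph $K_{12s+1}$ has a nearly triangular minimum genus embedding whose only nontriangular face is a single $6$-gon. That is, there is a cellular embedding of $K_{12s+1}$ in a closed orientable surface such that 1. the genus of the surface is the minimum genus $\gamma(K_{12s+1})$, i.e. the smallest genus over all cellular embeddings of $K_{12s+1}$ in closed orientable surfaces; 2. the embedding is nearly triangular, i.e. at most one of its faces is not $3$-sided; and 3. exactly one face is not $3$-sided, and this face is $6$-sided. Here cellular embeddings of a finite simple connected graph $G=(V,E)$ in closed orientable surfaces are given combinatorially by rotation systems: a rotation system assigns to each vertex $v$ a cyclic permutation of the edge ends at $v$. Let $\Phi$ be the resulting permutation of the set of all edge ends, and let $\theta$ be the involution exchanging the two ends of each edge. The faces are the cycles of $\Phi\circ\theta$, the length of a face (the $k$ for which it is $k$-sided) is the length of the cycle, and, with $F$ the set of faces, the genus $g$ is determined by $|V|-|E|+|F|=2-2g$. -/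

import Mathlib

/-- A rotation system of a simple graph `G`: a cyclic permutation, at each vertex `v`, of the edge
ends (darts) at `v`. The dart `(v, w)` is the end at `v` of the edge `vw`. The rotations at all the
vertices are collected in a single permutation `rot` of the darts that preserves the initial
vertex; by `cyclic` it permutes the darts at each vertex in one cycle.

By the Heffter-Edmonds principle, for a finite connected graph with at least one edge these are the
cellular embeddings in closed oriented surfaces, up to homeomorphism of pairs. -/
structure RotationSystem {V : Type*} (G : SimpleGraph V) where
  rot : Equiv.Perm G.Dart
  rot_fst : ∀ d : G.Dart, (rot d).fst = d.fst
  cyclic : ∀ d e : G.Dart, d.fst = e.fst → rot.SameCycle d e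

namespace RotationSystem

variable {V : Type*} {G : SimpleGraph V}

/-- The involution exchanging the two ends of every edge. -/
def flip (G : SimpleGraph V) : Equiv.Perm G.Dart :=
  Function.Involutive.toPerm SimpleGraph.Dart.symm SimpleGraph.Dart.symm_involutive

/-- The face-tracing permutation: exchange the ends of the edge, then rotate. -/
def facePerm (φ : RotationSystem G) : Equiv.Perm G.Dart :=
  φ.rot * flip G

/-- The faces of the embedding: the cycles of the face-tracing permutation. -/
def Face (φ : RotationSystem G) : Type _ :=
  Quotient (Equiv.Perm.SameCycle.setoid φ.facePerm)

/-- The face whose boundary walk traverses the dart `d` (in the direction of `d`). -/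
def faceOf (φ : RotationSystem G) (d : G.Dart) : φ.Face :=
  Quotient.mk (Equiv.Perm.SameCycle.setoid φ.facePerm) d

/-- The length of a face: the number of steps of its boundary walk, an edge being counted twice
if the walk traverses it in both directions. -/
noncomputable def faceLength (φ : RotationSystem G) (f : φ.Face) : ℕ :=
  {d : G.Dart | φ.faceOf d = f}.ncard

/-- The Euler characteristic `|V| - |E| + |F|`. -/
noncomputable def eulerChar (φ : RotationSystem G) : ℤ :=
  (Nat.card V : ℤ) - (Nat.card G.edgeSet : ℤ) + (Nat.card φ.Face : ℤ)

/-- The embedding is in the orientable surface of genus `g`: the Euler polyhedral equation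
`|V| - |E| + |F| = 2 - 2 g` (for finite connected `G` with at least one edge). -/
def HasGenus (φ : RotationSystem G) (g : ℕ) : Prop :=
  φ.eulerChar = 2 - 2 * (g : ℤ)

/-- At most one face is not a triangle. -/
def IsNearlyTriangular (φ : RotationSystem G) : Prop :=
  ∀ f f' : φ.Face, φ.faceLength f ≠ 3 → φ.faceLength f' ≠ 3 → f = f'

end RotationSystem

/-- The minimum genus of a graph: the smallest genus over all its embeddings. -/
noncomputable def minimumGenus {V : Type*} (G : SimpleGraph V) : ℕ :=
  sInf {g : ℕ | ∃ ψ : RotationSystem G, ψ.HasGenus g}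

/-- The genus of the embedding is the minimum genus of the graph. -/
def RotationSystem.IsMinimumGenus {V : Type*} {G : SimpleGraph V} (φ : RotationSystem G) : Prop :=
  φ.HasGenus (minimumGenus G)

/-! Put n = 12s+1. Every face of an embedding of K_n has length at least 3, so 3F ≤ n(n-1). Equality
would make the Euler characteristic 1 + 10s - 24s², which is odd, whereas 2 - 2g is even. Hence at
least one face is lost, and an embedding with one hexagon and triangles otherwise loses exactly one,
so its genus is minimum (`isMinimumGenus_of_hexagon`).

To build one, start from K_n minus a triangle xyz, with vertices ℤ/(12s-2) and x, y, z. It has a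
triangular embedding invariant under translation, of the kind given by an index-one current graph:
the rotation at 0 is a cyclic order of the nonzero differences and x, y, z, encoded in `nextDiff`,
and the rotation at i is its translate. Three facts are needed. Faces are triangles because of
Kirchhoff's law d = e + `nextDiff`(-e) for e = `nextDiff` d (`nextDiff_spec`). The order is a single
cycle (`nextDiff_induction`). The rotations at x, y, z, which are translations by the differences
preceding them, are single cycles since these differences generate ℤ/(12s-2) (`exists_mul_gap`).

Finally, one handle supplies the edges xy, yz, xz. Eight triangles, with 24 arcs, are destroyed;
with the 6 new arcs these form eight triangles and one hexagon (`HandleSite.τ_τ`). So E grows by 3,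
F by 1, and the Euler characteristic drops by 2. -/

/-! ### Surgery on cyclic permutations. -/

namespace Equiv.Perm

variable {α : Type*}

/-- All points of `s` lie in one cycle of `g` if this holds along an auxiliary cycle. -/
theorem sameCycle_of_forall_sameCycle_apply {f g : Perm α} {s : Set α}
    (hs : ∀ a ∈ s, f a ∈ s) (h : ∀ a ∈ s, g.SameCycle a (f a)) {a : α} (ha : a ∈ s) (n : ℕ) :
    g.SameCycle a ((f ^ n) a) := by
  induction n generalizing a with
  | zero => simp [SameCycle.refl]
  | succ n ih =>
    rw [pow_succ, mul_apply]
    exact (h a ha).trans (ih (hs a ha))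

/-- `f` permutes `s` in one cycle and fixes all other points. -/
structure Cycles (f : Perm α) (s : Set α) : Prop where
  fixed : ∀ a, a ∉ s → f a = a
  mapsTo : ∀ a ∈ s, f a ∈ s
  sameCycle : ∀ a ∈ s, ∀ b ∈ s, f.SameCycle a b

theorem Cycles.exists_pow [Finite α] {f : Perm α} {s : Set α} (h : f.Cycles s) {a b : α} (ha : a ∈ s) (hb : b ∈ s) :
    ∃ n : ℕ, (f ^ n) a = b := by
  obtain ⟨n, hn⟩ := (h.sameCycle a ha b hb).exists_nat_pow_eq
  exact ⟨n, hn⟩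

variable [DecidableEq α]

/-- `f` with the fixed point `b` inserted after `a`. -/
def insertAfter (f : Perm α) (a b : α) : Perm α := f * swap a b

theorem insertAfter_apply (f : Perm α) {a b : α} (hb : f b = b) (p : α) :
    f.insertAfter a b p = if p = a then b else if p = b then f a else f p := by
  unfold insertAfter
  rw [mul_apply]
  split_ifs with h1 h2
  · subst h1; rw [swap_apply_left, hb]
  · subst h2; rw [swap_apply_right]
  · rw [swap_apply_of_ne_of_ne h1 h2]

/-- `f` with the point `b` made a fixed point. -/
def bypass (f : Perm α) (b : α) : Perm α := swap b (f b) * f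

theorem bypass_apply (f : Perm α) {a b : α} (ha : f a = b) (p : α) :
    f.bypass b p = if p = b then b else if p = a then f b else f p := by
  unfold bypass
  rw [mul_apply]
  split_ifs with h1 h2
  · subst h1; rw [swap_apply_right]
  · subst h2; rw [ha, swap_apply_left]
  · rw [swap_apply_of_ne_of_ne _ (f.injective.ne h1)]
    rw [← ha]
    exact f.injective.ne h2

/-- `f` with the point `b` moved to the place after `a`. -/
def moveAfter (f : Perm α) (a b : α) : Perm α := (f.bypass b).insertAfter a b

theorem moveAfter_apply (f : Perm α) {a b c : α} (hc : f c = b) (hab : a ≠ b) (hac : a ≠ c)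
    (p : α) :
    f.moveAfter a b p =
      if p = a then b else if p = b then f a else if p = c then f b else f p := by
  have hb : f.bypass b b = b := by rw [bypass_apply f hc, if_pos rfl]
  unfold moveAfter
  rw [insertAfter_apply _ hb, bypass_apply f hc, bypass_apply f hc, if_neg hab, if_neg hac]
  split_ifs <;> rfl

namespace Cycles

variable {f : Perm α} {s : Set α} [Finite α]

theorem insertAfter (h : f.Cycles s) {a b : α} (ha : a ∈ s) (hb : b ∉ s) :
    (f.insertAfter a b).Cycles (insert b s) := by
  have hfb := h.fixed b hb
  have hab : a ≠ b := fun e => hb (e ▸ ha)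
  have hg := insertAfter_apply f (a := a) hfb
  have hga : f.insertAfter a b a = b := by rw [hg, if_pos rfl]
  have hgb : f.insertAfter a b b = f a := by rw [hg, if_neg hab.symm, if_pos rfl]
  have h1 : ∀ p ∈ s, (f.insertAfter a b).SameCycle p (f p) := by
    intro p hp
    by_cases hpa : p = a
    · subst hpa
      exact ⟨2, by rw [zpow_ofNat, pow_two, mul_apply, hga, hgb]⟩
    · have hpb : p ≠ b := fun e => hb (e ▸ hp)
      exact ⟨1, by rw [zpow_one, hg, if_neg hpa, if_neg hpb]⟩
  have h2 : ∀ p ∈ s, (f.insertAfter a b).SameCycle a p := by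
    intro p hp
    obtain ⟨n, rfl⟩ := h.exists_pow ha hp
    exact sameCycle_of_forall_sameCycle_apply h.mapsTo h1 ha n
  have h3 : ∀ p ∈ insert b s, (f.insertAfter a b).SameCycle a p := by
    rintro p (rfl | hp)
    · exact ⟨1, by rw [zpow_one, hga]⟩
    · exact h2 p hp
  refine ⟨fun p hp => ?_, ?_, fun p hp q hq => (h3 p hp).symm.trans (h3 q hq)⟩
  · rw [Set.mem_insert_iff, not_or] at hp
    rw [hg, if_neg (fun e : p = a => hp.2 (e ▸ ha)), if_neg hp.1, h.fixed p hp.2]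
  · rintro p (rfl | hp)
    · rw [hgb]; exact Or.inr (h.mapsTo a ha)
    · rw [hg]
      split_ifs
      · exact Or.inl rfl
      · exact Or.inr (h.mapsTo a ha)
      · exact Or.inr (h.mapsTo p hp)

theorem bypass (h : f.Cycles s) {b : α} (hb : b ∈ s) : (f.bypass b).Cycles (s \ {b}) := by
  obtain ⟨c, hc⟩ := f.surjective b
  have hg := bypass_apply f hc
  -- Induction is strong because passing the predecessor of b uses up two steps of f at once.
  have key : ∀ n : ℕ, ∀ p ∈ s \ {b}, (f ^ n) p ≠ b → (f.bypass b).SameCycle p ((f ^ n) p) := by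
    intro n
    induction n using Nat.strong_induction_on with
    | _ n ih =>
    intro p hp hn
    rcases n with _ | n
    · simp [SameCycle.refl]
    have hpb : p ≠ b := hp.2
    rw [pow_succ, mul_apply] at hn ⊢
    by_cases hpc : p = c
    · subst hpc
      rcases n with _ | n
      · exact absurd hc hn
      rw [hc] at hn ⊢
      rw [pow_succ, mul_apply] at hn ⊢
      have h1 : f.bypass b p = f b := by rw [hg, if_neg hpb, if_pos rfl]
      by_cases hbb : f b = b
      · exact absurd (f.injective (hc.trans hbb.symm)) hpb
      exact SameCycle.trans ⟨1, by rw [zpow_one, h1]⟩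
        (ih n (by omega) (f b) ⟨h.mapsTo b hb, hbb⟩ hn)
    · have h1 : f.bypass b p = f p := by rw [hg, if_neg hpb, if_neg hpc]
      have h2 : f p ≠ b := fun e => hpc (f.injective (e.trans hc.symm))
      exact SameCycle.trans ⟨1, by rw [zpow_one, h1]⟩
        (ih n (by omega) (f p) ⟨h.mapsTo p hp.1, h2⟩ hn)
  refine ⟨fun p hp => ?_, fun p hp => ?_, fun p hp q hq => ?_⟩
  · rw [hg]
    split_ifs with h1 h2
    · exact h1.symm
    · subst h2
      have hps : p ∉ s := fun e => hp ⟨e, h1⟩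
      exact absurd (h.fixed p hps ▸ hc : p = b) h1
    · exact h.fixed p fun e => hp ⟨e, h1⟩
  · have hpb : p ≠ b := hp.2
    rw [hg, if_neg hpb]
    split_ifs with h2
    · refine ⟨h.mapsTo b hb, fun e => hpb ?_⟩
      rw [h2]; exact f.injective (hc.trans (Set.mem_singleton_iff.1 e).symm)
    · exact ⟨h.mapsTo p hp.1, fun e => h2 (f.injective ((Set.mem_singleton_iff.1 e).trans hc.symm))⟩
  · obtain ⟨n, rfl⟩ := h.exists_pow hp.1 hq.1
    exact key n p hp hq.2

theorem moveAfter (h : f.Cycles s) {a b : α} (ha : a ∈ s) (hb : b ∈ s) (hab : a ≠ b) :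
    (f.moveAfter a b).Cycles s := by
  have h1 := (h.bypass hb).insertAfter (a := a) (b := b) ⟨ha, hab⟩ (fun e => e.2 rfl)
  rwa [Set.insert_sdiff_singleton, Set.insert_eq_of_mem hb] at h1

end Cycles

end Equiv.Perm

/-! ### Face lengths and minimum genus for complete graphs. -/

namespace RotationSystem

open SimpleGraph

section Faces

variable {V : Type*} {G : SimpleGraph V}

theorem facePerm_apply (φ : RotationSystem G) (d : G.Dart) : φ.facePerm d = φ.rot d.symm := rfl

theorem facePerm_fst (φ : RotationSystem G) (d : G.Dart) : (φ.facePerm d).fst = d.snd := by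
  rw [facePerm_apply, φ.rot_fst]; rfl

theorem faceOf_eq_iff (φ : RotationSystem G) (d e : G.Dart) :
    φ.faceOf d = φ.faceOf e ↔ φ.facePerm.SameCycle d e :=
  Quotient.eq (r := Equiv.Perm.SameCycle.setoid φ.facePerm)

theorem exists_faceOf_eq (φ : RotationSystem G) (f : φ.Face) : ∃ d, φ.faceOf d = f :=
  Quotient.exists_rep f

theorem faceLength_faceOf [Finite V] (φ : RotationSystem G) (d : G.Dart) (k : ℕ) (hk : 0 < k)
    (hd : (φ.facePerm ^ k) d = d)
    (hinj : Set.InjOn (fun i : ℕ => (φ.facePerm ^ i) d) (Set.Iio k)) :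
    φ.faceLength (φ.faceOf d) = k := by
  have h : {e : G.Dart | φ.faceOf e = φ.faceOf d} =
      (fun i : ℕ => (φ.facePerm ^ i) d) '' Set.Iio k := by
    ext e
    rw [Set.mem_ofPred_eq, faceOf_eq_iff, Equiv.Perm.sameCycle_comm]
    constructor
    · rintro ⟨n, rfl⟩
      have hk' : (0 : ℤ) < k := by exact_mod_cast hk
      refine ⟨(n % k).toNat, ?_, ?_⟩
      · have := Int.emod_lt_of_pos n hk'
        have := Int.emod_nonneg n hk'.ne'
        rw [Set.mem_Iio]; omega
      · have h1 : (((n % k).toNat : ℕ) : ℤ) = n % k := Int.toNat_of_nonneg (Int.emod_nonneg n hk'.ne')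
        have h2 : (φ.facePerm ^ ((k : ℤ) * (n / k))) d = d := by
          rw [zpow_mul, zpow_natCast]
          exact Equiv.Perm.zpow_apply_eq_self_of_apply_eq_self hd _
        change (φ.facePerm ^ (n % k).toNat) d = _
        rw [← zpow_natCast, h1]
        conv_rhs => rw [← Int.emod_add_mul_ediv n k, zpow_add, Equiv.Perm.mul_apply, h2]
    · rintro ⟨i, -, rfl⟩
      exact ⟨i, by simp⟩
  rw [faceLength, h, hinj.ncard_image, Set.ncard_Iio_nat]

end Faces

variable {V : Type*}

theorem facePerm_ne (φ : RotationSystem (completeGraph V)) (d : (completeGraph V).Dart) :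
    φ.facePerm d ≠ d := fun h => by
  have := φ.facePerm_fst d
  rw [h] at this
  exact d.adj.ne this

/-- A digon would run along one edge and back, so the rotation would fix a dart; this contradicts
cyclicity at a vertex of degree at least 2. -/
theorem facePerm_sq_ne [Fintype V] (hV : 3 ≤ Fintype.card V)
    (φ : RotationSystem (completeGraph V)) (d : (completeGraph V).Dart) :
    φ.facePerm (φ.facePerm d) ≠ d := fun h => by
  have h1 : (φ.facePerm d).snd = d.fst := by
    rw [← φ.facePerm_fst (φ.facePerm d), h]
  have h2 : φ.facePerm d = d.symm := by
    ext
    · exact φ.facePerm_fst d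
    · exact h1
  rw [facePerm_apply] at h2
  classical
  obtain ⟨w, hw⟩ : ∃ w, w ∉ ({d.fst, d.snd} : Finset V) := by
    by_contra! hc
    have h3 := Finset.card_le_card (fun x _ => hc x : Finset.univ ⊆ ({d.fst, d.snd} : Finset V))
    have h4 := Finset.card_le_two (a := d.fst) (b := d.snd)
    rw [Finset.card_univ] at h3
    omega
  rw [Finset.mem_insert, Finset.mem_singleton, not_or] at hw
  let e : (completeGraph V).Dart := ⟨(d.snd, w), fun e => hw.2 e.symm⟩
  obtain ⟨n, hn⟩ := φ.cyclic d.symm e rfl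
  rw [Equiv.Perm.zpow_apply_eq_self_of_apply_eq_self h2] at hn
  exact hw.1 (congrArg (fun d : (completeGraph V).Dart => d.snd) hn).symm

theorem faceLength_eq_three [Fintype V] (hV : 3 ≤ Fintype.card V)
    (φ : RotationSystem (completeGraph V)) (d : (completeGraph V).Dart)
    (h : φ.facePerm (φ.facePerm (φ.facePerm d)) = d) : φ.faceLength (φ.faceOf d) = 3 := by
  refine φ.faceLength_faceOf d 3 (by norm_num) h ?_
  have h1 := φ.facePerm_ne d
  have h2 := φ.facePerm_sq_ne hV d
  have h3 := φ.facePerm_ne (φ.facePerm d)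
  intro i hi j hj hij
  rw [Set.mem_Iio] at hi hj
  interval_cases i <;> interval_cases j <;>
    simp [pow_succ, Equiv.Perm.mul_apply] at hij ⊢ <;> first
      | exact h1 hij | exact h1 hij.symm | exact h2 hij | exact h2 hij.symm

variable [Fintype V]

theorem sum_faceLength (φ : RotationSystem (completeGraph V)) [Fintype φ.Face] :
    ∑ f, φ.faceLength f = Fintype.card V * (Fintype.card V - 1) := by
  classical
  have h1 : ∑ f, φ.faceLength f = Fintype.card (completeGraph V).Dart := by
    rw [← Fintype.card_congr (Equiv.sigmaFiberEquiv φ.faceOf), Fintype.card_sigma]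
    refine Finset.sum_congr rfl fun f _ => ?_
    rw [faceLength, ← Nat.card_coe_set_eq, Nat.card_eq_fintype_card]
    rfl
  rw [h1]
  have h2 := (completeGraph V).sum_degrees_eq_twice_card_edges
  have h3 := (completeGraph V).dart_card_eq_sum_degrees
  rw [h3]
  have : ∀ v, (completeGraph V).degree v = Fintype.card V - 1 := fun v => by
    convert SimpleGraph.complete_graph_degree v
  simp [this]

theorem two_mul_card_edgeSet :
    2 * Nat.card (completeGraph V).edgeSet = Fintype.card V * (Fintype.card V - 1) := by
  classical
  have h2 := (completeGraph V).sum_degrees_eq_twice_card_edges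
  have : ∀ v, (completeGraph V).degree v = Fintype.card V - 1 := fun v => by
    convert SimpleGraph.complete_graph_degree v
  rw [Finset.sum_congr rfl fun v _ => this v] at h2
  rw [Nat.card_eq_fintype_card, ← SimpleGraph.edgeFinset_card, ← h2]
  simp

theorem three_le_faceLength (hV : 3 ≤ Fintype.card V) (φ : RotationSystem (completeGraph V))
    (f : φ.Face) : 3 ≤ φ.faceLength f := by
  classical
  obtain ⟨d, rfl⟩ := φ.exists_faceOf_eq f
  have h1 := φ.facePerm_ne d
  have h2 := φ.facePerm_sq_ne hV d
  have h3 := φ.facePerm_ne (φ.facePerm d)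
  have hsub : (({d, φ.facePerm d, φ.facePerm (φ.facePerm d)} : Finset _) : Set _) ⊆
      {e | φ.faceOf e = φ.faceOf d} := by
    intro e he
    rw [Set.mem_ofPred_eq, faceOf_eq_iff, Equiv.Perm.sameCycle_comm]
    simp only [Finset.coe_insert, Finset.coe_singleton, Set.mem_insert_iff,
      Set.mem_singleton_iff] at he
    rcases he with rfl | rfl | rfl
    · exact ⟨0, rfl⟩
    · exact ⟨1, rfl⟩
    · exact ⟨2, rfl⟩
  have h4 := Set.ncard_le_ncard hsub (Set.toFinite _)
  rw [Set.ncard_coe_finset, Finset.card_eq_three.2 ⟨_, _, _, h1.symm, h2.symm, h3.symm, rfl⟩] at h4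
  exact h4

theorem three_mul_card_face_le (hV : 3 ≤ Fintype.card V) (φ : RotationSystem (completeGraph V)) :
    3 * Nat.card φ.Face ≤ Fintype.card V * (Fintype.card V - 1) := by
  classical
  have : Finite φ.Face := Quotient.finite _
  have := Fintype.ofFinite φ.Face
  rw [← φ.sum_faceLength, Nat.card_eq_fintype_card, mul_comm, ← smul_eq_mul, ← Finset.card_univ]
  exact Finset.card_nsmul_le_sum _ _ _ fun f _ => φ.three_le_faceLength hV f

theorem three_mul_card_face_add_three (φ : RotationSystem (completeGraph V)) (f : φ.Face)
    (hf : φ.faceLength f = 6) (h : ∀ f', f' ≠ f → φ.faceLength f' = 3) :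
    3 * Nat.card φ.Face + 3 = Fintype.card V * (Fintype.card V - 1) := by
  classical
  have : Finite φ.Face := Quotient.finite _
  have := Fintype.ofFinite φ.Face
  rw [← φ.sum_faceLength, Nat.card_eq_fintype_card, ← Finset.card_univ,
    ← Finset.add_sum_erase _ _ (Finset.mem_univ f), hf,
    Finset.sum_congr rfl fun f' hf' => h f' (Finset.ne_of_mem_erase hf'), Finset.sum_const,
    Finset.card_erase_of_mem (Finset.mem_univ f), smul_eq_mul]
  have : 0 < (Finset.univ : Finset φ.Face).card := Finset.card_pos.2 ⟨f, Finset.mem_univ f⟩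
  omega

theorem isMinimumGenus_of_hexagon {s : ℕ} (hs : 1 ≤ s) (hV : Fintype.card V = 12 * s + 1)
    (φ : RotationSystem (completeGraph V)) (f : φ.Face) (hf : φ.faceLength f = 6)
    (h : ∀ f', f' ≠ f → φ.faceLength f' = 3) : φ.IsMinimumGenus := by
  have hE := two_mul_card_edgeSet (V := V)
  have hF := φ.three_mul_card_face_add_three f hf h
  rw [hV, Nat.add_sub_cancel] at hE hF
  -- This is (n-3)(n-4)/12 rounded up, for n = 12s+1; by `h5` the subtraction is not truncated.
  have hg : φ.HasGenus (12 * s ^ 2 + 1 - 5 * s) := by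
    have h5 : 5 * s ≤ 12 * s ^ 2 + 1 := by nlinarith
    unfold HasGenus eulerChar
    rw [Nat.card_eq_fintype_card, hV]
    push_cast [Nat.cast_sub h5]
    zify at hE hF
    linarith
  -- Another embedding has at most one face more, and by parity of the Euler characteristic one more
  -- face cannot lower the genus.
  have hmin : ∀ g, (∃ ψ : RotationSystem (completeGraph V), ψ.HasGenus g) →
      12 * s ^ 2 + 1 - 5 * s ≤ g := by
    rintro g ⟨ψ, hψ⟩
    have hF' := three_mul_card_face_le (by omega) ψ
    rw [hV, Nat.add_sub_cancel] at hF'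
    unfold HasGenus eulerChar at hψ hg
    omega
  unfold IsMinimumGenus
  rwa [show minimumGenus (completeGraph V) = 12 * s ^ 2 + 1 - 5 * s from
    le_antisymm (Nat.sInf_le ⟨φ, hg⟩) (le_csInf ⟨_, φ, hg⟩ hmin)]

end RotationSystem

namespace Equiv.Perm

theorem Cycles.permCongr {α β : Type*} {f : Perm α} {s : Set α} (h : f.Cycles s) (e : α ≃ β) :
    (e.permCongr f).Cycles (e.symm ⁻¹' s) := by
  refine ⟨fun b hb => ?_, fun b hb => ?_, fun b hb c hc => ?_⟩
  · rw [permCongr_apply, h.fixed _ hb, e.apply_symm_apply]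
  · rw [Set.mem_preimage, permCongr_apply, e.symm_apply_apply]
    exact h.mapsTo _ hb
  · obtain ⟨n, hn⟩ := h.sameCycle _ hb _ hc
    refine ⟨n, ?_⟩
    have h1 : e.permCongr f ^ n = e.permCongr (f ^ n) := (map_zpow e.permCongrHom f n).symm
    rw [h1, permCongr_apply, hn, e.apply_symm_apply]

end Equiv.Perm

/-! ### Rotation systems from permutations of the vertices. -/

namespace RotationSystem

open SimpleGraph Equiv

section OfPerm

variable {V : Type*}

/-- The permutation of the darts of the complete graph that acts at `v` by `σ v`. -/
def dartPerm (σ : V → Perm V) (h : ∀ v, (σ v).Cycles {v}ᶜ) : Perm (completeGraph V).Dart where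
  toFun := fun d => ⟨(d.fst, σ d.fst d.snd), fun e => (h d.fst).mapsTo d.snd d.adj.ne' e.symm⟩
  invFun := fun d => ⟨(d.fst, (σ d.fst).symm d.snd), fun e => d.adj.ne <| by
    have h1 := (h d.fst).fixed d.fst (fun h => h rfl)
    conv_lhs => rw [← h1]
    exact (Equiv.eq_symm_apply _).1 e⟩
  left_inv := fun d => by ext <;> simp
  right_inv := fun d => by ext <;> simp

theorem dartPerm_zpow (σ : V → Perm V) (h : ∀ v, (σ v).Cycles {v}ᶜ) (n : ℤ) :
    ∀ d, ((dartPerm σ h ^ n) d).fst = d.fst ∧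
      ((dartPerm σ h ^ n) d).snd = (σ d.fst ^ n) d.snd := by
  induction n using Int.induction_on with
  | zero => intro d; simp
  | succ n ih =>
    intro d
    rw [zpow_add_one, Perm.mul_apply, zpow_add_one, Perm.mul_apply, (ih _).1, (ih _).2]
    exact ⟨rfl, rfl⟩
  | pred n ih =>
    intro d
    rw [zpow_sub_one, Perm.mul_apply, zpow_sub_one, Perm.mul_apply, (ih _).1, (ih _).2]
    exact ⟨rfl, rfl⟩

/-- The rotation system of the complete graph whose rotation at `v` is the cycle `σ v`. -/
def ofPerm (σ : V → Perm V) (h : ∀ v, (σ v).Cycles {v}ᶜ) : RotationSystem (completeGraph V) where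
  rot := dartPerm σ h
  rot_fst := fun d => rfl
  cyclic := by
    rintro ⟨⟨v, a⟩, hva⟩ ⟨⟨w, b⟩, hwb⟩ (rfl : v = w)
    obtain ⟨n, hn⟩ := (h v).sameCycle a (Ne.symm hva) b (Ne.symm hwb)
    refine ⟨n, ?_⟩
    obtain ⟨h1, h2⟩ := dartPerm_zpow σ h n ⟨(v, a), hva⟩
    ext
    · exact h1
    · exact h2.trans hn

variable [Fintype V]

/-- After the arc from p to q, a face continues to σ q p. Thus `tri` says that the walk returns to p
after three arcs. -/
theorem exists_hexagon_of_perm (σ : V → Perm V) (h : ∀ v, (σ v).Cycles {v}ᶜ) (hV : 3 ≤ Fintype.card V) (c : Fin 6 → V)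
    (hc : Function.Injective c) (hex : ∀ i, σ (c (i + 1)) (c i) = c (i + 2))
    (tri : ∀ p q, p ≠ q → (∀ i, ¬(p = c i ∧ q = c (i + 1))) → σ (σ q p) q = p) :
    ∃ (φ : RotationSystem (completeGraph V)) (f : φ.Face),
      φ.faceLength f = 6 ∧ ∀ f', f' ≠ f → φ.faceLength f' = 3 := by
  set φ := ofPerm σ h with hφ
  let d : Fin 6 → (completeGraph V).Dart := fun i => ⟨(c i, c (i + 1)), fun e => by
    have := hc e
    clear e
    revert i
    decide⟩
  have hd : ∀ i, φ.facePerm (d i) = d (i + 1) := by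
    intro i
    ext
    · rfl
    · change σ (c (i + 1)) (c i) = c (i + 1 + 1)
      rw [hex, add_assoc]
      rfl
  have hpow : ∀ n : ℕ, (φ.facePerm ^ n) (d 0) = d (Fin.ofNat 6 n) := by
    intro n
    induction n with
    | zero => rfl
    | succ n ih =>
      rw [pow_succ', Perm.mul_apply, ih, hd]
      congr 1
      ext
      simp [Fin.val_add, Fin.ofNat]
  have hface : ∀ i, φ.faceOf (d i) = φ.faceOf (d 0) := by
    intro i
    rw [faceOf_eq_iff, Perm.sameCycle_comm]
    refine ⟨(i.val : ℕ), ?_⟩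
    rw [zpow_natCast, hpow]
    congr 1
    ext
    simp [Fin.ofNat]
  refine ⟨φ, φ.faceOf (d 0), ?_, ?_⟩
  · refine φ.faceLength_faceOf (d 0) 6 (by norm_num) (by rw [hpow]; rfl) ?_
    intro i hi j hj hij
    have h1 : c (Fin.ofNat 6 i) = c (Fin.ofNat 6 j) := by
      have := congrArg (fun d : (completeGraph V).Dart => d.fst) hij
      simp only [hpow] at this
      exact this
    have h2 := congrArg Fin.val (hc h1)
    rw [Set.mem_Iio] at hi hj
    simp only [Fin.ofNat] at h2
    omega
  · intro f' hf'
    obtain ⟨e, rfl⟩ := φ.exists_faceOf_eq f'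
    have step : ∀ e : (completeGraph V).Dart, φ.faceOf e ≠ φ.faceOf (d 0) →
        σ (σ e.snd e.fst) e.snd = e.fst := by
      intro e he
      refine tri _ _ e.adj.ne fun i hi => he ?_
      rw [← hface i]
      congr 1
      ext
      · exact hi.1
      · exact hi.2
    refine φ.faceLength_eq_three hV e ?_
    -- The next arc is also off the hexagon. Closing at both arcs fixes the two endpoints of the
    -- third iterate.
    have h1 : φ.faceOf (φ.facePerm e) = φ.faceOf e := by
      rw [faceOf_eq_iff, Perm.sameCycle_apply_left]
    have h2 := step e hf'
    have h3 := step (φ.facePerm e) (by rwa [h1])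
    ext
    · exact h2
    · change σ (σ (σ e.snd e.fst) e.snd) (σ e.snd e.fst) = e.snd
      exact h3

end OfPerm

end RotationSystem

/-! ### Attaching a handle to a triangular embedding of the complete graph minus a triangle. -/

namespace RotationSystem

open SimpleGraph Equiv

/-- Rotations of a triangular embedding of a complete graph minus the triangle `x y z`, with eight
faces around which a handle can be attached. -/
structure HandleSite (V : Type*) where
  σ : V → Perm V
  (o a b c d e x y z : V)
  nodup : [o, a, b, c, d, e, x, y, z].Nodup
  cycles : ∀ v, v ≠ x → v ≠ y → v ≠ z → (σ v).Cycles {v}ᶜ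
  cycles_x : (σ x).Cycles {x, y, z}ᶜ
  cycles_y : (σ y).Cycles {x, y, z}ᶜ
  cycles_z : (σ z).Cycles {x, y, z}ᶜ
  triangle : ∀ p q, p ≠ q → ¬((p = x ∨ p = y ∨ p = z) ∧ (q = x ∨ q = y ∨ q = z)) →
    σ (σ q p) q = p
  -- The faces, in order: bzc, oba, abd, cza, oxd, oez, ocy, odc.
  z_b : σ z b = c
  b_o : σ b o = a
  b_a : σ b a = d
  z_c : σ z c = a
  x_o : σ x o = d
  e_o : σ e o = z
  c_o : σ c o = y
  d_o : σ d o = c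

namespace HandleSite

variable {V : Type*} (H : HandleSite V)

theorem ne : (H.o ≠ H.a ∧ H.o ≠ H.b ∧ H.o ≠ H.c ∧ H.o ≠ H.d ∧ H.o ≠ H.e ∧ H.o ≠ H.x ∧ H.o ≠ H.y ∧
      H.o ≠ H.z) ∧
    (H.a ≠ H.b ∧ H.a ≠ H.c ∧ H.a ≠ H.d ∧ H.a ≠ H.e ∧ H.a ≠ H.x ∧ H.a ≠ H.y ∧ H.a ≠ H.z) ∧
    (H.b ≠ H.c ∧ H.b ≠ H.d ∧ H.b ≠ H.e ∧ H.b ≠ H.x ∧ H.b ≠ H.y ∧ H.b ≠ H.z) ∧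
    (H.c ≠ H.d ∧ H.c ≠ H.e ∧ H.c ≠ H.x ∧ H.c ≠ H.y ∧ H.c ≠ H.z) ∧
    (H.d ≠ H.e ∧ H.d ≠ H.x ∧ H.d ≠ H.y ∧ H.d ≠ H.z) ∧
    (H.e ≠ H.x ∧ H.e ≠ H.y ∧ H.e ≠ H.z) ∧ (H.x ≠ H.y ∧ H.x ≠ H.z) ∧ H.y ≠ H.z := by
  have h := H.nodup
  simp only [List.nodup_cons, List.mem_cons, List.not_mem_nil, or_false, not_or,
    List.nodup_nil, and_true, not_false_eq_true] at h
  exact h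

theorem rotate {p q r : V} (h : H.σ q p = r) (hpq : p ≠ q)
    (hv : ¬((p = H.x ∨ p = H.y ∨ p = H.z) ∧ (q = H.x ∨ q = H.y ∨ q = H.z))) : H.σ r q = p :=
  h ▸ H.triangle p q hpq hv

/-- A triangular face determines one rotation entry at each of its corners; these are the two that
the site does not list. -/
theorem values : (H.σ H.c H.z = H.b ∧ H.σ H.b H.c = H.z) ∧ (H.σ H.a H.b = H.o ∧ H.σ H.o H.a = H.b) ∧
    (H.σ H.d H.b = H.a ∧ H.σ H.a H.d = H.b) ∧ (H.σ H.a H.z = H.c ∧ H.σ H.c H.a = H.z) ∧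
    (H.σ H.d H.x = H.o ∧ H.σ H.o H.d = H.x) ∧ (H.σ H.z H.e = H.o ∧ H.σ H.o H.z = H.e) ∧
    (H.σ H.y H.c = H.o ∧ H.σ H.o H.y = H.c) ∧ (H.σ H.c H.d = H.o ∧ H.σ H.o H.c = H.d) := by
  obtain ⟨⟨oa, ob, oc, od, oe, ox, oy, oz⟩, ⟨ab, ac, ad, ae, ax, ay, az⟩,
    ⟨bc, bd, be, bx, bY, bz⟩, ⟨cd, ce, cx, cy, cz⟩, ⟨de, dx, dy, dz⟩, ⟨ex, ey, ez⟩,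
    ⟨xy, xz⟩, yz⟩ := H.ne
  have two : ∀ {p q r : V}, H.σ q p = r → p ≠ q → q ≠ r →
      ¬((p = H.x ∨ p = H.y ∨ p = H.z) ∧ (q = H.x ∨ q = H.y ∨ q = H.z)) →
      ¬((q = H.x ∨ q = H.y ∨ q = H.z) ∧ (r = H.x ∨ r = H.y ∨ r = H.z)) →
      H.σ r q = p ∧ H.σ p r = q :=
    fun h hpq hqr hv hv' => ⟨H.rotate h hpq hv, H.rotate (H.rotate h hpq hv) hqr hv'⟩
  exact ⟨two H.z_b bz cz.symm (by tauto) (by tauto), two H.b_o ob ab.symm (by tauto) (by tauto),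
    two H.b_a ab bd (by tauto) (by tauto), two H.z_c cz az.symm (by tauto) (by tauto),
    two H.x_o ox dx.symm (by tauto) (by tauto), two H.e_o oe ez (by tauto) (by tauto),
    two H.c_o oc cy (by tauto) (by tauto), two H.d_o od cd.symm (by tauto) (by tauto)⟩

variable [DecidableEq V]

/-- The rotations after attaching the handle and inserting the edges `xy`, `yz`, `xz`. -/
def τ (v : V) : Perm V :=
  if v = H.o then ((H.σ v).moveAfter H.z H.c).moveAfter H.a H.d
  else if v = H.a then (H.σ v).moveAfter H.z H.b
  else if v = H.b then (H.σ v).moveAfter H.c H.a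
  else if v = H.c then (H.σ v).moveAfter H.o H.z
  else if v = H.d then (H.σ v).moveAfter H.b H.o
  else if v = H.x then ((H.σ v).insertAfter H.o H.y).insertAfter H.y H.z
  else if v = H.y then ((H.σ v).insertAfter H.c H.z).insertAfter H.z H.x
  else if v = H.z then (((H.σ v).moveAfter H.e H.c).insertAfter H.e H.y).insertAfter H.e H.x
  else H.σ v

theorem τ_o : H.τ H.o = ((H.σ H.o).moveAfter H.z H.c).moveAfter H.a H.d := if_pos rfl

theorem τ_a : H.τ H.a = (H.σ H.a).moveAfter H.z H.b := by
  have := H.ne; grind [τ]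

theorem τ_b : H.τ H.b = (H.σ H.b).moveAfter H.c H.a := by
  have := H.ne; grind [τ]

theorem τ_c : H.τ H.c = (H.σ H.c).moveAfter H.o H.z := by
  have := H.ne; grind [τ]

theorem τ_d : H.τ H.d = (H.σ H.d).moveAfter H.b H.o := by
  have := H.ne; grind [τ]

theorem τ_x : H.τ H.x = ((H.σ H.x).insertAfter H.o H.y).insertAfter H.y H.z := by
  have := H.ne; grind [τ]

theorem τ_y : H.τ H.y = ((H.σ H.y).insertAfter H.c H.z).insertAfter H.z H.x := by
  have := H.ne; grind [τ]

theorem τ_z : H.τ H.z =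
    (((H.σ H.z).moveAfter H.e H.c).insertAfter H.e H.y).insertAfter H.e H.x := by
  have := H.ne; grind [τ]

theorem τ_other {v : V} (h : v ≠ H.o ∧ v ≠ H.a ∧ v ≠ H.b ∧ v ≠ H.c ∧ v ≠ H.d ∧ v ≠ H.x ∧ v ≠ H.y ∧
    v ≠ H.z) : H.τ v = H.σ v := by
  grind [τ]

/-- Moving a point within a cycle leaves one cycle on the same set; at x, y, z the insertions add
exactly the two missing neighbours. -/
theorem cycles_τ [Finite V] (v : V) : (H.τ v).Cycles {v}ᶜ := by
  obtain ⟨⟨oa, ob, oc, od, oe, ox, oy, oz⟩, ⟨ab, ac, ad, ae, ax, ay, az⟩,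
    ⟨bc, bd, be, bx, bY, bz⟩, ⟨cd, ce, cx, cy, cz⟩, ⟨de, dx, dy, dz⟩, ⟨ex, ey, ez⟩,
    ⟨xy, xz⟩, yz⟩ := H.ne
  by_cases v1 : v = H.o
  · subst v1; rw [τ_o]
    exact ((H.cycles _ ox oy oz).moveAfter oz.symm oc.symm cz.symm).moveAfter oa.symm od.symm ad
  by_cases v2 : v = H.a
  · subst v2; rw [τ_a]
    exact (H.cycles _ ax ay az).moveAfter az.symm ab.symm bz.symm
  by_cases v3 : v = H.b
  · subst v3; rw [τ_b]
    exact (H.cycles _ bx bY bz).moveAfter bc.symm ab ac.symm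
  by_cases v4 : v = H.c
  · subst v4; rw [τ_c]
    exact (H.cycles _ cx cy cz).moveAfter oc cz.symm oz
  by_cases v5 : v = H.d
  · subst v5; rw [τ_d]
    exact (H.cycles _ dx dy dz).moveAfter bd od ob.symm
  have hmem : ∀ {v}, v ≠ H.x → v ≠ H.y → v ≠ H.z → v ∈ ({H.x, H.y, H.z}ᶜ : Set V) := by
    intro v h1 h2 h3 h
    rcases h with h | h | h
    exacts [h1 h, h2 h, h3 h]
  by_cases v6 : v = H.x
  · subst v6; rw [τ_x]
    convert (H.cycles_x.insertAfter (a := H.o) (b := H.y) (hmem ox oy oz)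
      (by simp)).insertAfter (a := H.y) (b := H.z) (Or.inl rfl)
      (by simp only [Set.mem_insert_iff, Set.mem_compl_iff, Set.mem_singleton_iff]; tauto) using 1
    ext w
    simp only [Set.mem_insert_iff, Set.mem_compl_iff, Set.mem_singleton_iff]
    grind
  by_cases v7 : v = H.y
  · subst v7; rw [τ_y]
    convert (H.cycles_y.insertAfter (a := H.c) (b := H.z) (hmem cx cy cz)
      (by simp)).insertAfter (a := H.z) (b := H.x) (Or.inl rfl)
      (by simp only [Set.mem_insert_iff, Set.mem_compl_iff, Set.mem_singleton_iff]; tauto) using 1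
    ext w
    simp only [Set.mem_insert_iff, Set.mem_compl_iff, Set.mem_singleton_iff]
    grind
  by_cases v8 : v = H.z
  · subst v8; rw [τ_z]
    convert ((H.cycles_z.moveAfter (hmem ex ey ez) (hmem cx cy cz) ce.symm).insertAfter
      (a := H.e) (b := H.y) (hmem ex ey ez) (by simp)).insertAfter (a := H.e) (b := H.x)
      (Or.inr (hmem ex ey ez))
      (by simp only [Set.mem_insert_iff, Set.mem_compl_iff, Set.mem_singleton_iff]; tauto) using 1
    ext w
    simp only [Set.mem_insert_iff, Set.mem_compl_iff, Set.mem_singleton_iff]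
    grind
  rw [H.τ_other (by tauto)]
  exact H.cycles v v6 v7 v8

theorem τ_o_apply (p : V) : H.τ H.o p = if p = H.z then H.c else if p = H.c then H.e else
    if p = H.y then H.x else if p = H.a then H.d else if p = H.d then H.b else H.σ H.o p := by
  obtain ⟨⟨oa, ob, oc, od, oe, ox, oy, oz⟩, ⟨ab, ac, ad, ae, ax, ay, az⟩,
    ⟨bc, bd, be, bx, bY, bz⟩, ⟨cd, ce, cx, cy, cz⟩, ⟨de, dx, dy, dz⟩, ⟨ex, ey, ez⟩,
    ⟨xy, xz⟩, yz⟩ := H.ne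
  obtain ⟨-, ⟨-, h1⟩, -, -, ⟨-, h2⟩, ⟨-, h3⟩, ⟨-, h4⟩, -, h5⟩ := H.values
  have h := Perm.moveAfter_apply (H.σ H.o) h4 cz.symm yz.symm
  rw [τ_o, Perm.moveAfter_apply (c := H.y) _ (by grind) ad ay]
  grind

theorem τ_a_apply (p : V) : H.τ H.a p = if p = H.z then H.b else if p = H.b then H.c else
    if p = H.d then H.o else H.σ H.a p := by
  obtain ⟨⟨oa, ob, oc, od, oe, ox, oy, oz⟩, ⟨ab, ac, ad, ae, ax, ay, az⟩,
    ⟨bc, bd, be, bx, bY, bz⟩, ⟨cd, ce, cx, cy, cz⟩, ⟨de, dx, dy, dz⟩, -⟩ := H.ne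
  rw [τ_a, Perm.moveAfter_apply _ H.values.2.2.1.2 bz.symm dz.symm, H.values.2.1.1,
    H.values.2.2.2.1.1]

theorem τ_b_apply (p : V) : H.τ H.b p = if p = H.c then H.a else if p = H.a then H.z else
    if p = H.o then H.d else H.σ H.b p := by
  obtain ⟨⟨oa, ob, oc, od, oe, ox, oy, oz⟩, ⟨ab, ac, ad, ae, ax, ay, az⟩, -⟩ := H.ne
  rw [τ_b, Perm.moveAfter_apply _ H.b_o ac.symm oc.symm, H.values.1.2, H.b_a]

theorem τ_c_apply (p : V) : H.τ H.c p = if p = H.o then H.z else if p = H.z then H.y else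
    if p = H.a then H.b else H.σ H.c p := by
  obtain ⟨⟨oa, ob, oc, od, oe, ox, oy, oz⟩, -⟩ := H.ne
  rw [τ_c, Perm.moveAfter_apply _ H.values.2.2.2.1.2 oz oa, H.c_o, H.values.1.1]

theorem τ_d_apply (p : V) : H.τ H.d p = if p = H.b then H.o else if p = H.o then H.a else
    if p = H.x then H.c else H.σ H.d p := by
  obtain ⟨⟨oa, ob, oc, od, oe, ox, oy, oz⟩, ⟨ab, ac, ad, ae, ax, ay, az⟩,
    ⟨bc, bd, be, bx, bY, bz⟩, -⟩ := H.ne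
  rw [τ_d, Perm.moveAfter_apply _ H.values.2.2.2.2.1.1 ob.symm bx, H.values.2.2.1.1, H.d_o]

theorem τ_x_apply (p : V) : H.τ H.x p = if p = H.o then H.y else if p = H.y then H.z else
    if p = H.z then H.d else H.σ H.x p := by
  have hy : H.σ H.x H.y = H.y := H.cycles_x.fixed _ (by simp)
  have hz : H.σ H.x H.z = H.z := H.cycles_x.fixed _ (by simp)
  have h := Perm.insertAfter_apply (H.σ H.x) (a := H.o) hy
  have h5 := H.x_o
  obtain ⟨⟨-, -, -, -, -, ox, oy, oz⟩, -, -, -, -, -, ⟨xy, xz⟩, yz⟩ := H.ne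
  rw [τ_x, Perm.insertAfter_apply _ (by grind)]
  grind

theorem τ_y_apply (p : V) : H.τ H.y p = if p = H.c then H.z else if p = H.z then H.x else
    if p = H.x then H.o else H.σ H.y p := by
  have hx : H.σ H.y H.x = H.x := H.cycles_y.fixed _ (by simp)
  have hz : H.σ H.y H.z = H.z := H.cycles_y.fixed _ (by simp)
  have h := Perm.insertAfter_apply (H.σ H.y) (a := H.c) hz
  have h7 := H.values.2.2.2.2.2.2.1.1
  obtain ⟨-, -, -, ⟨-, -, cx, cy, cz⟩, -, -, ⟨xy, xz⟩, yz⟩ := H.ne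
  rw [τ_y, Perm.insertAfter_apply _ (by grind)]
  grind

theorem τ_z_apply (p : V) : H.τ H.z p = if p = H.e then H.x else if p = H.x then H.y else
    if p = H.y then H.c else if p = H.c then H.o else if p = H.b then H.a else H.σ H.z p := by
  have hx : H.σ H.z H.x = H.x := H.cycles_z.fixed _ (by simp)
  have hy : H.σ H.z H.y = H.y := H.cycles_z.fixed _ (by simp)
  have h4 := H.z_c
  have h6 := H.values.2.2.2.2.2.1.1
  obtain ⟨-, -, ⟨-, -, be, bx, bY, bz⟩, ⟨-, ce, cx, cy, cz⟩, -, ⟨ex, ey, ez⟩, ⟨xy, xz⟩, yz⟩ := H.ne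
  have h := Perm.moveAfter_apply (H.σ H.z) H.z_b ce.symm be.symm
  have h' := Perm.insertAfter_apply ((H.σ H.z).moveAfter H.e H.c) (a := H.e) (b := H.y) (by grind)
  rw [τ_z, Perm.insertAfter_apply _ (by grind)]
  grind

end HandleSite

end RotationSystem

/-! ### Faces after the handle is attached. -/

namespace RotationSystem

open SimpleGraph Equiv

namespace HandleSite

variable {V : Type*} (H : HandleSite V) [DecidableEq V]

theorem σ_apply_ne {p q : V} (hpq : p ≠ q) : H.σ q p ≠ q := by
  have hq : H.σ q q = q := by
    by_cases hx : q = H.x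
    · subst hx; exact H.cycles_x.fixed _ (by simp)
    by_cases hy : q = H.y
    · subst hy; exact H.cycles_y.fixed _ (by simp)
    by_cases hz : q = H.z
    · subst hz; exact H.cycles_z.fixed _ (by simp)
    exact (H.cycles q hx hy hz).fixed _ (by simp)
  exact fun h => hpq ((H.σ q).injective (h.trans hq.symm))

theorem eq_or_τ_eq (v : V) : v = H.o ∨ v = H.a ∨ v = H.b ∨ v = H.c ∨ v = H.d ∨ v = H.x ∨ v = H.y ∨
    v = H.z ∨ H.τ v = H.σ v := by
  have := H.τ_other (v := v)
  tauto

theorem τ_τ_o {p : V} (hp : p ≠ H.o) (h : p ≠ H.c) : H.τ (H.τ H.o p) H.o = p := by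
  have hne := H.ne
  have hq := H.τ_o_apply p
  have ha := H.τ_a_apply H.o
  have hb := H.τ_b_apply H.o
  have hc := H.τ_c_apply H.o
  have hd := H.τ_d_apply H.o
  have hx := H.τ_x_apply H.o
  have hy := H.τ_y_apply H.o
  have hz := H.τ_z_apply H.o
  have hv := H.eq_or_τ_eq (H.σ H.o p)
  have ht := H.triangle p H.o
  have hval := H.values
  have w1 := H.z_b
  have w2 := H.b_o
  have w3 := H.b_a
  have w4 := H.z_c
  have w5 := H.x_o
  have w6 := H.e_o
  have w7 := H.c_o
  have w8 := H.d_o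
  have hm := H.σ_apply_ne hp
  grind (splits := 30)

theorem τ_τ_a {p : V} (hp : p ≠ H.a) : H.τ (H.τ H.a p) H.a = p := by
  have hne := H.ne
  have hq := H.τ_a_apply p
  have ho := H.τ_o_apply H.a
  have hb := H.τ_b_apply H.a
  have hc := H.τ_c_apply H.a
  have hd := H.τ_d_apply H.a
  have hx := H.τ_x_apply H.a
  have hy := H.τ_y_apply H.a
  have hz := H.τ_z_apply H.a
  have hv := H.eq_or_τ_eq (H.σ H.a p)
  have ht := H.triangle p H.a
  have hval := H.values
  have w1 := H.z_b
  have w2 := H.b_o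
  have w3 := H.b_a
  have w4 := H.z_c
  have w5 := H.x_o
  have w6 := H.e_o
  have w7 := H.c_o
  have w8 := H.d_o
  have hm := H.σ_apply_ne hp
  grind (splits := 30)

theorem τ_τ_b {p : V} (hp : p ≠ H.b) : H.τ (H.τ H.b p) H.b = p := by
  have hne := H.ne
  have hq := H.τ_b_apply p
  have ho := H.τ_o_apply H.b
  have ha := H.τ_a_apply H.b
  have hc := H.τ_c_apply H.b
  have hd := H.τ_d_apply H.b
  have hx := H.τ_x_apply H.b
  have hy := H.τ_y_apply H.b
  have hz := H.τ_z_apply H.b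
  have hv := H.eq_or_τ_eq (H.σ H.b p)
  have ht := H.triangle p H.b
  have hval := H.values
  have w1 := H.z_b
  have w2 := H.b_o
  have w3 := H.b_a
  have w4 := H.z_c
  have w5 := H.x_o
  have w6 := H.e_o
  have w7 := H.c_o
  have w8 := H.d_o
  have hm := H.σ_apply_ne hp
  grind (splits := 30)

theorem τ_τ_c {p : V} (hp : p ≠ H.c) (h : p ≠ H.d) : H.τ (H.τ H.c p) H.c = p := by
  have hne := H.ne
  have hq := H.τ_c_apply p
  have ho := H.τ_o_apply H.c
  have ha := H.τ_a_apply H.c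
  have hb := H.τ_b_apply H.c
  have hd := H.τ_d_apply H.c
  have hx := H.τ_x_apply H.c
  have hy := H.τ_y_apply H.c
  have hz := H.τ_z_apply H.c
  have hv := H.eq_or_τ_eq (H.σ H.c p)
  have ht := H.triangle p H.c
  have hval := H.values
  have w1 := H.z_b
  have w2 := H.b_o
  have w3 := H.b_a
  have w4 := H.z_c
  have w5 := H.x_o
  have w6 := H.e_o
  have w7 := H.c_o
  have w8 := H.d_o
  have hm := H.σ_apply_ne hp
  grind (splits := 30)

theorem τ_τ_d {p : V} (hp : p ≠ H.d) (h : p ≠ H.x) : H.τ (H.τ H.d p) H.d = p := by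
  have hne := H.ne
  have hq := H.τ_d_apply p
  have ho := H.τ_o_apply H.d
  have ha := H.τ_a_apply H.d
  have hb := H.τ_b_apply H.d
  have hc := H.τ_c_apply H.d
  have hx := H.τ_x_apply H.d
  have hy := H.τ_y_apply H.d
  have hz := H.τ_z_apply H.d
  have hv := H.eq_or_τ_eq (H.σ H.d p)
  have ht := H.triangle p H.d
  have hval := H.values
  have w1 := H.z_b
  have w2 := H.b_o
  have w3 := H.b_a
  have w4 := H.z_c
  have w5 := H.x_o
  have w6 := H.e_o
  have w7 := H.c_o
  have w8 := H.d_o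
  have hm := H.σ_apply_ne hp
  grind (splits := 30)

theorem τ_τ_x {p : V} (hp : p ≠ H.x) (h : p ≠ H.z) : H.τ (H.τ H.x p) H.x = p := by
  have hne := H.ne
  have hq := H.τ_x_apply p
  have ho := H.τ_o_apply H.x
  have ha := H.τ_a_apply H.x
  have hb := H.τ_b_apply H.x
  have hc := H.τ_c_apply H.x
  have hd := H.τ_d_apply H.x
  have hy := H.τ_y_apply H.x
  have hz := H.τ_z_apply H.x
  have hv := H.eq_or_τ_eq (H.σ H.x p)
  have ht := H.triangle p H.x
  have hval := H.values
  have w1 := H.z_b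
  have w2 := H.b_o
  have w3 := H.b_a
  have w4 := H.z_c
  have w5 := H.x_o
  have w6 := H.e_o
  have w7 := H.c_o
  have w8 := H.d_o
  have hm := H.σ_apply_ne hp
  -- The old embedding has no edge from x to y or z, so an old entry at x cannot lead to those
  -- vertices, whose rotations have changed.
  have hs : p ≠ H.x → p ≠ H.y → p ≠ H.z →
      H.σ H.x p ≠ H.x ∧ H.σ H.x p ≠ H.y ∧ H.σ H.x p ≠ H.z := by
    intro h1 h2 h3
    have := H.cycles_x.mapsTo p (by simp [h1, h2, h3])
    simpa using this
  grind (splits := 30)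

theorem τ_τ_y {p : V} (hp : p ≠ H.y) : H.τ (H.τ H.y p) H.y = p := by
  have hne := H.ne
  have hq := H.τ_y_apply p
  have ho := H.τ_o_apply H.y
  have ha := H.τ_a_apply H.y
  have hb := H.τ_b_apply H.y
  have hc := H.τ_c_apply H.y
  have hd := H.τ_d_apply H.y
  have hx := H.τ_x_apply H.y
  have hz := H.τ_z_apply H.y
  have hv := H.eq_or_τ_eq (H.σ H.y p)
  have ht := H.triangle p H.y
  have hval := H.values
  have w1 := H.z_b
  have w2 := H.b_o
  have w3 := H.b_a
  have w4 := H.z_c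
  have w5 := H.x_o
  have w6 := H.e_o
  have w7 := H.c_o
  have w8 := H.d_o
  have hm := H.σ_apply_ne hp
  have hs : p ≠ H.x → p ≠ H.y → p ≠ H.z →
      H.σ H.y p ≠ H.x ∧ H.σ H.y p ≠ H.y ∧ H.σ H.y p ≠ H.z := by
    intro h1 h2 h3
    have := H.cycles_y.mapsTo p (by simp [h1, h2, h3])
    simpa using this
  grind (splits := 30)

theorem τ_τ_z {p : V} (hp : p ≠ H.z) (h : p ≠ H.e) : H.τ (H.τ H.z p) H.z = p := by
  have hne := H.ne
  have hq := H.τ_z_apply p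
  have ho := H.τ_o_apply H.z
  have ha := H.τ_a_apply H.z
  have hb := H.τ_b_apply H.z
  have hc := H.τ_c_apply H.z
  have hd := H.τ_d_apply H.z
  have hx := H.τ_x_apply H.z
  have hy := H.τ_y_apply H.z
  have hv := H.eq_or_τ_eq (H.σ H.z p)
  have ht := H.triangle p H.z
  have hval := H.values
  have w1 := H.z_b
  have w2 := H.b_o
  have w3 := H.b_a
  have w4 := H.z_c
  have w5 := H.x_o
  have w6 := H.e_o
  have w7 := H.c_o
  have w8 := H.d_o
  have hm := H.σ_apply_ne hp
  have hs : p ≠ H.x → p ≠ H.y → p ≠ H.z →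
      H.σ H.z p ≠ H.x ∧ H.σ H.z p ≠ H.y ∧ H.σ H.z p ≠ H.z := by
    intro h1 h2 h3
    have := H.cycles_z.mapsTo p (by simp [h1, h2, h3])
    simpa using this
  grind (splits := 30)

end HandleSite

end RotationSystem

namespace RotationSystem

open SimpleGraph Equiv

namespace HandleSite

variable {V : Type*} (H : HandleSite V) [DecidableEq V]

/-- The excluded arcs bound the hexagon o e z x d c. The new triangles are zoc, yox, aod, dob, zab,
bac, zcy and yxz; all other faces are old. -/
theorem τ_τ {p q : V} (hpq : p ≠ q)
    (h : ¬((p = H.o ∧ q = H.e) ∨ (p = H.e ∧ q = H.z) ∨ (p = H.z ∧ q = H.x) ∨ (p = H.x ∧ q = H.d) ∨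
      (p = H.d ∧ q = H.c) ∨ (p = H.c ∧ q = H.o))) : H.τ (H.τ q p) q = p := by
  by_cases ho : q = H.o
  · subst ho; exact H.τ_τ_o hpq (by tauto)
  by_cases ha : q = H.a
  · subst ha; exact H.τ_τ_a hpq
  by_cases hb : q = H.b
  · subst hb; exact H.τ_τ_b hpq
  by_cases hc : q = H.c
  · subst hc; exact H.τ_τ_c hpq (by tauto)
  by_cases hd : q = H.d
  · subst hd; exact H.τ_τ_d hpq (by tauto)
  by_cases hx : q = H.x
  · subst hx; exact H.τ_τ_x hpq (by tauto)
  by_cases hy : q = H.y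
  · subst hy; exact H.τ_τ_y hpq
  by_cases hz : q = H.z
  · subst hz; exact H.τ_τ_z hpq (by tauto)
  have hq := H.τ_other ⟨ho, ha, hb, hc, hd, hx, hy, hz⟩
  have ht := H.triangle p q hpq (by tauto)
  have hv := H.eq_or_τ_eq (H.σ q p)
  have h1 := H.τ_o_apply q
  have h2 := H.τ_a_apply q
  have h3 := H.τ_b_apply q
  have h4 := H.τ_c_apply q
  have h5 := H.τ_d_apply q
  have h6 := H.τ_x_apply q
  have h7 := H.τ_y_apply q
  have h8 := H.τ_z_apply q
  -- For q with unchanged rotation, the only changed entry at q in another rotation is at z for q =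
  -- e. There the old face is oez, so p = o, which is excluded.
  have h9 := H.values.2.2.2.2.2.1.1
  grind (splits := 30)

theorem exists_hexagon [Fintype V] (H : HandleSite V) :
    ∃ (φ : RotationSystem (completeGraph V)) (f : φ.Face),
      φ.faceLength f = 6 ∧ ∀ f', f' ≠ f → φ.faceLength f' = 3 := by
  have hcard : 3 ≤ Fintype.card V := by
    have := H.nodup.length_le_card
    simp only [List.length_cons, List.length_nil] at this
    omega
  have hne := H.ne
  refine exists_hexagon_of_perm H.τ H.cycles_τ hcard ![H.o, H.e, H.z, H.x, H.d, H.c] ?_ ?_ ?_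
  · intro i j hij
    fin_cases i <;> fin_cases j <;> first | rfl | (exfalso; simp at hij; grind)
  · have ho := H.τ_o_apply H.c
    have hc := H.τ_c_apply H.d
    have hd := H.τ_d_apply H.x
    have hx := H.τ_x_apply H.z
    have hz := H.τ_z_apply H.e
    have he : H.τ H.e = H.σ H.e := H.τ_other (by tauto)
    have he' := H.e_o
    have hv := H.values.2.2.2.2.2.2.2.1
    intro i
    fin_cases i
    · change H.τ H.e H.o = H.z; rw [he, he']
    · change H.τ H.z H.e = H.x; grind
    · change H.τ H.x H.z = H.d; grind
    · change H.τ H.d H.x = H.c; grind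
    · change H.τ H.c H.d = H.o; grind
    · change H.τ H.o H.c = H.e; grind
  · intro p q hpq hn
    refine H.τ_τ hpq ?_
    rintro (h | h | h | h | h | h)
    exacts [hn 0 h, hn 1 h, hn 2 h, hn 3 h, hn 4 h, hn 5 h]

end HandleSite

end RotationSystem

/-! ### The cyclic order of differences. -/

namespace RotationSystem

/-- The rotation at the vertex `0` of `ℤ / (12 s - 2)`, on representatives; the values `12 s - 2`,
`12 s - 1`, `12 s` stand for the three additional vertices. -/
def nextDiff (s d : ℤ) : ℤ :=
  if d ≤ 6 * s - 2 then
    (if d ≤ 3 * s then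
      (if d ≤ 2 * s - 1 then
        (if d ≤ 1 then
          (10 * s - 2)
        else
          (if d ≤ 2 * s - 2 then
            (if d % 2 = 0 then 5 * s - 1 + d / 2 else 9 * s - 2 + d / 2)
          else
            (5 * s - 1)))
      else
        (if d ≤ 2 * s + 1 then
          (if d ≤ 2 * s then
            (2 * s + 1)
          else
            (12 * s - 1))
        else
          (if d ≤ 3 * s - 1 then
            (6 * s + 1 - d)
          else
            (10 * s - 1))))
    else
      (if d ≤ 4 * s then
        (if d ≤ 4 * s - 2 then
          (6 * s - d)
        else
          (if d ≤ 4 * s - 1 then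
            (12 * s)
          else
            (10 * s)))
      else
        (if d ≤ 5 * s - 1 then
          (if d ≤ 5 * s - 2 then
            (2 * d + 2 * s)
          else
            (3 * s + 1))
        else
          (if d ≤ 5 * s then
            (2 * s)
          else
            (2 * d + 1 - 10 * s)))))
  else
    (if d ≤ 9 * s - 3 then
      (if d ≤ 7 * s - 1 then
        (if d ≤ 6 * s - 1 then
          (2 * s - 1)
        else
          (if d ≤ 7 * s - 2 then
            (14 * s - 2 - d)
          else
            (9 * s - 2)))
      else
        (if d ≤ 8 * s - 1 then
          (if d ≤ 8 * s - 2 then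
            (14 * s - 3 - d)
          else
            -- For s = 2 the block from 10s+1 to 12s-4 is empty, and the order continues directly at
            -- 2s-2 = 2.
            (if s = 2 then 2 else 10 * s + 1))
        else
          (if d ≤ 9 * s - 4 then
            (2 * d + 3 - 6 * s)
          else
            (2 * s - 2))))
    else
      (if d ≤ 10 * s - 2 then
        (if d ≤ 10 * s - 4 then
          (if d ≤ 9 * s - 2 then
            (7 * s - 2)
          else
            (2 * d + 4 - 18 * s))
        else
          (if d ≤ 10 * s - 3 then
            (12 * s - 3)
          else
            (3 * s)))
      else
        (if d ≤ 10 * s then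
          (if d ≤ 10 * s - 1 then
            (4 * s)
          else
            (7 * s - 1))
        else
          (if d ≤ 12 * s - 4 then
            (if d % 2 = 1 then 4 * s + (d + 1 - 10 * s) / 2 else 8 * s + (d - 2 - 10 * s) / 2)
          else
            (12 * s - 2)))))

set_option maxHeartbeats 4000000 in
-- Kirchhoff's law modulo 12s-2: seen from the neighbour at difference e, the centre lies at -e and
-- the third corner of the face at d - e.
theorem nextDiff_spec {s d : ℤ} (hs : 2 ≤ s) (h1 : 1 ≤ d) (hd : d < 12 * s - 2) :
    (1 ≤ nextDiff s d ∧ nextDiff s d < 12 * s - 2 ∧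
      nextDiff s (12 * s - 2 - nextDiff s d) < 12 * s - 2 ∧
      (nextDiff s (12 * s - 2 - nextDiff s d) + nextDiff s d = d ∨
        nextDiff s (12 * s - 2 - nextDiff s d) + nextDiff s d = d + (12 * s - 2))) ∨
    (nextDiff s d = 12 * s - 2 ∧ d = 12 * s - 3) ∨ (nextDiff s d = 12 * s - 1 ∧ d = 2 * s + 1) ∨
      (nextDiff s d = 12 * s ∧ d = 4 * s - 1) := by
  generalize he : nextDiff s d = e
  unfold nextDiff at he
  repeat' split at he
  all_goals first
    | omega
    | (left; refine ⟨by omega, by omega, ?_, ?_⟩ <;> unfold nextDiff <;> omega)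

/-- Following the order from 1 meets every difference. It leaves the differences only at y and z,
whose successors are -(2s+1) and -(4s-1), and closes up through x, from 12s-3 = -1 back to 1. -/
theorem nextDiff_induction {s : ℤ} (hs : 2 ≤ s) {P : ℤ → Prop} (one : P 1)
    (step : ∀ d, 1 ≤ d → d < 12 * s - 2 → nextDiff s d < 12 * s - 2 → P d → P (nextDiff s d))
    (hy : P (2 * s + 1) → P (10 * s - 3)) (hz : P (4 * s - 1) → P (8 * s - 1)) (d : ℤ)
    (h1 : 1 ≤ d) (hd : d < 12 * s - 2) : P d := by
  have next : ∀ d e, 1 ≤ d ∧ d < 12 * s - 2 ∧ e < 12 * s - 2 ∧ nextDiff s d = e → P d → P e := by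
    rintro d e ⟨h1, h2, h3, rfl⟩
    exact step d h1 h2 h3
  have a1 := next 1 (10 * s - 2) (by unfold nextDiff; omega) one
  have a2 := next _ (3 * s) (by unfold nextDiff; omega) a1
  have a3 := next _ (10 * s - 1) (by unfold nextDiff; omega) a2
  have a4 := next _ (4 * s) (by unfold nextDiff; omega) a3
  have a5 := next _ (10 * s) (by unfold nextDiff; omega) a4
  have a6 := next _ (7 * s - 1) (by unfold nextDiff; omega) a5
  have a7 := next _ (9 * s - 2) (by unfold nextDiff; omega) a6
  -- Zigzag outward around 7s-1: consecutive sums alternate between 14s-2 and 14s-3.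
  have b : ∀ i : ℕ, i ≤ s - 2 → P (7 * s - 2 - i) ∧ P (7 * s + i) := by
    intro i
    induction i with
    | zero =>
      intro _
      have := next _ (7 * s - 2) (by unfold nextDiff; omega) a7
      exact ⟨by simpa using this, next (7 * s - 2) _ (by unfold nextDiff; omega) this⟩
    | succ i ih =>
      intro hi
      have h := next _ (7 * s - 2 - (i + 1 : ℕ)) (by unfold nextDiff; omega) (ih (by omega)).2
      exact ⟨h, next _ _ (by unfold nextDiff; omega) h⟩
  have b' := (b (s - 2).toNat (by omega)).2
  have a8 := next _ (6 * s - 1) (by unfold nextDiff; omega) b'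
  have a9 := next _ (2 * s - 1) (by unfold nextDiff; omega) a8
  have a10 := next _ (5 * s - 1) (by unfold nextDiff; omega) a9
  -- Zigzag outward around 3s, with sums 6s and 6s+1. It stops at 4s-1, where z follows; hence the
  -- guard on the last round.
  have c : ∀ i : ℕ, i ≤ s - 2 → P (3 * s + 1 + i) ∧ (i ≤ s - 3 → P (3 * s - 1 - i)) := by
    intro i
    induction i with
    | zero =>
      intro _
      have := next _ (3 * s + 1) (by unfold nextDiff; omega) a10
      exact ⟨by simpa using this, fun _ => next (3 * s + 1) _ (by unfold nextDiff; omega) this⟩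
    | succ i ih =>
      intro hi
      have h := next _ (3 * s + 1 + (i + 1 : ℕ)) (by unfold nextDiff; omega)
        ((ih (by omega)).2 (by omega))
      exact ⟨h, fun _ => next _ _ (by unfold nextDiff; omega) h⟩
  have c' := (c (s - 2).toNat (by omega)).1
  have a11 : P (4 * s - 1) := by convert c' using 1; omega
  have a12 := hz a11
  -- Rounds of four steps that exhaust the interval from 10s+1 to 12s-4; there are none when s = 2.
  have f : ∀ i : ℕ, i ≤ s - 3 → P (10 * s + 1 + 2 * i) ∧ P (4 * s + 1 + i) ∧
      P (10 * s + 2 + 2 * i) ∧ P (8 * s + i) := by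
    have key : ∀ i : ℕ, i ≤ s - 3 → P (10 * s + 1 + 2 * i) → P (10 * s + 1 + 2 * i) ∧
        P (4 * s + 1 + i) ∧ P (10 * s + 2 + 2 * i) ∧ P (8 * s + i) := by
      intro i hi h1
      have h2 := next _ (4 * s + 1 + i) (by unfold nextDiff; omega) h1
      have h3 := next _ (10 * s + 2 + 2 * i) (by unfold nextDiff; omega) h2
      exact ⟨h1, h2, h3, next _ _ (by unfold nextDiff; omega) h3⟩
    intro i
    induction i with
    | zero => exact fun hi => key 0 hi (next _ _ (by unfold nextDiff; omega) a12)
    | succ i ih =>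
      exact fun hi => key _ hi (next _ _ (by unfold nextDiff; omega) (ih (by omega)).2.2.2)
  have a13 : P (2 * s - 2) := by
    rcases eq_or_ne s 2 with h | h
    · exact next _ _ (by unfold nextDiff; omega) a12
    · exact next _ _ (by unfold nextDiff; omega) (f (s - 3).toNat (by omega)).2.2.2
  -- Descending rounds of four steps; the last one breaks off after 2 and 5s, whence the order goes
  -- to 2s.
  have g : ∀ i : ℕ, i ≤ s - 2 → P (2 * s - 2 - 2 * i) ∧ P (6 * s - 2 - i) ∧
      (i ≤ s - 3 → P (2 * s - 3 - 2 * i) ∧ P (10 * s - 4 - i)) := by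
    have key : ∀ i : ℕ, i ≤ s - 2 → P (2 * s - 2 - 2 * i) → P (2 * s - 2 - 2 * i) ∧
        P (6 * s - 2 - i) ∧ (i ≤ s - 3 → P (2 * s - 3 - 2 * i) ∧ P (10 * s - 4 - i)) := by
      intro i hi h1
      have h2 := next _ (6 * s - 2 - i) (by unfold nextDiff; omega) h1
      refine ⟨h1, h2, fun hi' => ?_⟩
      have h3 := next _ (2 * s - 3 - 2 * i) (by unfold nextDiff; omega) h2
      exact ⟨h3, next _ _ (by unfold nextDiff; omega) h3⟩
    intro i
    induction i with
    | zero => exact fun hi => key 0 hi (by simpa using a13)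
    | succ i ih =>
      exact fun hi => key _ hi (next _ _ (by unfold nextDiff; omega)
        ((ih (by omega)).2.2 (by omega)).2)
  have a14 := next _ (2 * s) (by unfold nextDiff; omega) (g (s - 2).toNat (by omega)).2.1
  have a15 := next _ (2 * s + 1) (by unfold nextDiff; omega) a14
  have a16 := hy a15
  have a17 := next _ (12 * s - 3) (by unfold nextDiff; omega) a16
  have out : ∀ e, P e → d = e → P d := fun e h h' => h' ▸ h
  rcases (by omega : d = 1 ∨ d = 2 * s - 1 ∨ d = 2 * s ∨ d = 2 * s + 1 ∨ d = 3 * s ∨ d = 4 * s ∨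
    d = 5 * s - 1 ∨ d = 6 * s - 1 ∨ d = 7 * s - 1 ∨ d = 8 * s - 1 ∨ d = 9 * s - 2 ∨
    d = 10 * s - 3 ∨ d = 10 * s - 2 ∨ d = 10 * s - 1 ∨ d = 10 * s ∨ d = 12 * s - 3 ∨
    (2 ≤ d ∧ d ≤ 2 * s - 2) ∨ (2 * s + 2 ≤ d ∧ d ≤ 3 * s - 1) ∨ (3 * s + 1 ≤ d ∧ d ≤ 4 * s - 1) ∨
    (4 * s + 1 ≤ d ∧ d ≤ 5 * s - 2) ∨ (5 * s ≤ d ∧ d ≤ 6 * s - 2) ∨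
    (6 * s ≤ d ∧ d ≤ 7 * s - 2) ∨ (7 * s ≤ d ∧ d ≤ 8 * s - 2) ∨ (8 * s ≤ d ∧ d ≤ 9 * s - 3) ∨
    (9 * s - 1 ≤ d ∧ d ≤ 10 * s - 4) ∨ (10 * s + 1 ≤ d ∧ d ≤ 12 * s - 4)) with
    h | h | h | h | h | h | h | h | h | h | h | h | h | h | h | h | h | h | h | h | h | h | h | h |
    h | h
  · exact out _ one h
  · exact out _ a9 h
  · exact out _ a14 h
  · exact out _ a15 h
  · exact out _ a2 h
  · exact out _ a4 h
  · exact out _ a10 h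
  · exact out _ a8 h
  · exact out _ a6 h
  · exact out _ a12 h
  · exact out _ a7 h
  · exact out _ a16 h
  · exact out _ a1 h
  · exact out _ a3 h
  · exact out _ a5 h
  · exact out _ a17 h
  · rcases Int.emod_two_eq_zero_or_one d with h' | h'
    · exact out _ (g ((2 * s - 2 - d) / 2).toNat (by omega)).1 (by omega)
    · exact out _ ((g ((2 * s - 3 - d) / 2).toNat (by omega)).2.2 (by omega)).1 (by omega)
  · exact out _ ((c (3 * s - 1 - d).toNat (by omega)).2 (by omega)) (by omega)
  · exact out _ (c (d - 3 * s - 1).toNat (by omega)).1 (by omega)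
  · exact out _ (f (d - 4 * s - 1).toNat (by omega)).2.1 (by omega)
  · exact out _ (g (6 * s - 2 - d).toNat (by omega)).2.1 (by omega)
  · exact out _ (b (7 * s - 2 - d).toNat (by omega)).1 (by omega)
  · exact out _ (b (d - 7 * s).toNat (by omega)).2 (by omega)
  · exact out _ (f (d - 8 * s).toNat (by omega)).2.2.2 (by omega)
  · exact out _ ((g (10 * s - 4 - d).toNat (by omega)).2.2 (by omega)).2 (by omega)
  · rcases Int.emod_two_eq_zero_or_one (d - 10 * s) with h' | h'
    · exact out _ (f ((d - 10 * s - 2) / 2).toNat (by omega)).2.2.1 (by omega)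
    · exact out _ (f ((d - 10 * s - 1) / 2).toNat (by omega)).1 (by omega)

end RotationSystem

/-! ### The translation-invariant triangular embedding. -/

namespace RotationSystem

open SimpleGraph Equiv

/-- The difference that precedes each of the three additional vertices in the rotation at `0`. -/
def gap (s : ℤ) : Fin 3 → ℤ := ![12 * s - 3, 2 * s + 1, 4 * s - 1]

/-- The successor of the second vertex in the rotation at the first vertex, in a triangular
embedding of the complete graph minus the triangle on the three additional vertices. -/
def nextVertex (s : ℕ) : ZMod (12 * s - 2) ⊕ Fin 3 → ZMod (12 * s - 2) ⊕ Fin 3 →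
    ZMod (12 * s - 2) ⊕ Fin 3
  | .inl i, .inl u =>
    if u = i then .inl i
    else if nextDiff s (u - i).val < 12 * s - 2 then .inl (i + (nextDiff s (u - i).val : ℤ))
    else .inr (Fin.ofNat 3 (nextDiff s (u - i).val - (12 * s - 2)).toNat)
  | .inl i, .inr w => .inl (i - (gap s w : ℤ))
  | .inr w, .inl u => .inl (u + (gap s w : ℤ))
  | .inr _, .inr w' => .inr w'

section

variable {s : ℕ} (hs : 2 ≤ s)

include hs in
theorem cast_eq_cast {a b : ℤ} (k : ℤ) (h : b - a = (12 * s - 2) * k) :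
    (a : ZMod (12 * s - 2)) = b := by
  rw [ZMod.intCast_eq_intCast_iff_dvd_sub]
  refine ⟨k, ?_⟩
  rw [h]
  push_cast [Nat.cast_sub (by omega : 2 ≤ 12 * s)]
  ring

include hs in
theorem val_cast {d : ℤ} (h1 : 1 ≤ d) (hd : d < 12 * s - 2) :
    ((d : ZMod (12 * s - 2)).val : ℤ) = d := by
  obtain ⟨n, rfl⟩ := Int.eq_ofNat_of_zero_le (by omega : 0 ≤ d)
  rw [Int.cast_natCast, ZMod.val_natCast_of_lt (by omega)]

include hs in
theorem cast_ne_zero {d : ℤ} (h1 : 1 ≤ d) (hd : d < 12 * s - 2) :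
    (d : ZMod (12 * s - 2)) ≠ 0 := fun h => by
  have := val_cast hs h1 hd
  rw [h, ZMod.val_zero] at this
  omega

include hs in
theorem nextVertex_add (i : ZMod (12 * s - 2)) {d : ℤ} (h1 : 1 ≤ d) (hd : d < 12 * s - 2) :
    nextVertex s (.inl i) (.inl (i + d)) =
      if nextDiff s d < 12 * s - 2 then .inl (i + (nextDiff s d : ℤ))
      else .inr (Fin.ofNat 3 (nextDiff s d - (12 * s - 2)).toNat) := by
  have h : i + (d : ZMod (12 * s - 2)) ≠ i := fun e => cast_ne_zero hs h1 hd (by simpa using e)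
  have h' : i + (d : ZMod (12 * s - 2)) - i = d := by ring
  simp only [nextVertex, if_neg h, h', val_cast hs h1 hd]

include hs in
theorem gap_bounds (w : Fin 3) : 1 ≤ gap s w ∧ gap s w < 12 * s - 2 := by
  fin_cases w <;> simp [gap] <;> omega

include hs in
theorem nextDiff_gap (w : Fin 3) : nextDiff s (gap s w) = 12 * s - 2 + w.val := by
  fin_cases w <;> simp [gap] <;> unfold nextDiff <;> omega

include hs in
theorem nextVertex_gap (i : ZMod (12 * s - 2)) (w : Fin 3) :
    nextVertex s (.inl i) (.inl (i + (gap s w : ℤ))) = .inr w := by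
  obtain ⟨h1, h2⟩ := gap_bounds hs w
  rw [nextVertex_add hs i h1 h2, nextDiff_gap hs, if_neg (by omega)]
  congr 1
  ext
  simp only [Fin.ofNat]
  omega

include hs in
theorem nextVertex_of_nextDiff (i : ZMod (12 * s - 2)) {d e : ℤ} (h1 : 1 ≤ d)
    (hd : d < 12 * s - 2) (h : nextDiff s d = e) (he : e < 12 * s - 2) :
    nextVertex s (.inl i) (.inl (i + d)) = .inl (i + e) := by
  subst h
  rw [nextVertex_add hs i h1 hd, if_pos he]

include hs in
theorem exists_eq_add {i u : ZMod (12 * s - 2)} (h : u ≠ i) :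
    ∃ d : ℤ, 1 ≤ d ∧ d < 12 * s - 2 ∧ u = i + d := by
  have : NeZero (12 * s - 2) := ⟨by omega⟩
  have h0 : (u - i).val ≠ 0 := by rwa [Ne, ZMod.val_eq_zero, sub_eq_zero]
  have h1 := ZMod.val_lt (u - i)
  refine ⟨(u - i).val, by omega, by omega, ?_⟩
  rw [Int.cast_natCast, ZMod.natCast_zmod_val]
  ring

include hs in
theorem nextDiff_cases {d : ℤ} (h1 : 1 ≤ d) (hd : d < 12 * s - 2) :
    (∃ e e' k : ℤ, 1 ≤ e ∧ e < 12 * s - 2 ∧ nextDiff s d = e ∧ nextDiff s (12 * s - 2 - e) = e' ∧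
      e' < 12 * s - 2 ∧ d - (e + e') = (12 * s - 2) * k) ∨ ∃ w, d = gap s w := by
  rcases nextDiff_spec (by omega) h1 hd with ⟨h1', h2, h3, h4 | h4⟩ | ⟨-, h⟩ | ⟨-, h⟩ | ⟨-, h⟩
  · exact Or.inl ⟨_, _, 0, h1', h2, rfl, rfl, h3, by omega⟩
  · exact Or.inl ⟨_, _, -1, h1', h2, rfl, rfl, h3, by omega⟩
  · exact Or.inr ⟨0, h⟩
  · exact Or.inr ⟨1, h⟩
  · exact Or.inr ⟨2, h⟩

theorem nextVertex_self (q : ZMod (12 * s - 2) ⊕ Fin 3) : nextVertex s q q = q := by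
  rcases q with i | w <;> simp [nextVertex]

include hs in
theorem nextVertex_nextVertex {p q : ZMod (12 * s - 2) ⊕ Fin 3} (hpq : p ≠ q)
    (h : ¬(p.isRight ∧ q.isRight)) : nextVertex s (nextVertex s q p) q = p := by
  rcases p with u | w <;> rcases q with i | w'
  · obtain ⟨d, h1, hd, rfl⟩ := exists_eq_add hs (fun e => hpq (congrArg _ e) : u ≠ i)
    rcases nextDiff_cases hs h1 hd with ⟨e, e', k, he1, he, hde, hee, he', hk⟩ | ⟨w, rfl⟩
    · rw [nextVertex_of_nextDiff hs i h1 hd hde he]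
      -- Seen from i + e, the vertex i is at difference -e, with representative 12s-2-e.
      have hi : i = i + e + ((12 * s - 2 - e : ℤ) : ZMod (12 * s - 2)) := by
        have : ((12 * s - 2 - e : ℤ) : ZMod (12 * s - 2)) = ((-e : ℤ) : ZMod (12 * s - 2)) :=
          cast_eq_cast hs (-1) (by ring)
        rw [this]; push_cast; ring
      conv_lhs => rw [show (Sum.inl i : ZMod (12 * s - 2) ⊕ Fin 3) = Sum.inl _ from congrArg _ hi]
      rw [nextVertex_of_nextDiff hs (i + e) (by omega) (by omega) hee he', add_assoc,
        ← Int.cast_add, cast_eq_cast hs k hk]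
    · rw [nextVertex_gap hs]; rfl
  · simp [nextVertex]
  · change nextVertex s (.inl (i - (gap s w : ℤ))) (.inl i) = .inr w
    have := nextVertex_gap hs (i - (gap s w : ℤ)) w
    rwa [sub_add_cancel] at this
  · simp at h

include hs in
theorem nextVertex_ne {p q : ZMod (12 * s - 2) ⊕ Fin 3} (hpq : p ≠ q) : nextVertex s q p ≠ q := by
  rcases p with u | w <;> rcases q with i | w'
  · obtain ⟨d, h1, hd, rfl⟩ := exists_eq_add hs (fun e => hpq (congrArg _ e) : u ≠ i)
    rcases nextDiff_cases hs h1 hd with ⟨e, e', k, he1, he, hde, -⟩ | ⟨w, rfl⟩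
    · rw [nextVertex_of_nextDiff hs i h1 hd hde he]
      intro h
      exact cast_ne_zero hs he1 he (by simpa using h)
    · rw [nextVertex_gap hs]; exact Sum.inr_ne_inl
  · exact Sum.inl_ne_inr
  · change Sum.inl _ ≠ Sum.inl i
    intro h
    obtain ⟨h1, h2⟩ := gap_bounds hs w
    exact cast_ne_zero hs h1 h2 (by simpa using h)
  · exact hpq

include hs in
-- At a vertex of ℤ/(12s-2), the triangle identity recovers a neighbour from its successor; at x, y,
-- z the map is a translation.
theorem nextVertex_injective (q : ZMod (12 * s - 2) ⊕ Fin 3) :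
    Function.Injective (nextVertex s q) := by
  intro p p' hp
  rcases q with i | w
  · by_cases h : p = .inl i
    · by_cases h' : p' = .inl i
      · rw [h, h']
      · rw [h, nextVertex_self] at hp
        exact absurd hp.symm (nextVertex_ne hs h')
    · by_cases h' : p' = .inl i
      · rw [h', nextVertex_self] at hp
        exact absurd hp (nextVertex_ne hs h)
      · rw [← nextVertex_nextVertex hs h (by simp), hp, nextVertex_nextVertex hs h' (by simp)]
  · rcases p with u | v <;> rcases p' with u' | v'
    · have : u + (gap s w : ZMod (12 * s - 2)) = u' + (gap s w : ZMod (12 * s - 2)) :=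
        Sum.inl_injective hp
      rw [add_right_cancel this]
    · exact absurd hp Sum.inl_ne_inr
    · exact absurd hp Sum.inr_ne_inl
    · exact hp

include hs in
-- All three differences are units: 12s-3 is -1; 12s-2 = 6(2s+1) - 8 with 2s+1 odd; and 12s-2 =
-- 3(4s-1) + 1.
theorem exists_mul_gap (w : Fin 3) : ∃ k : ℤ, ((k * gap s w : ℤ) : ZMod (12 * s - 2)) = 1 := by
  have h : IsCoprime (gap s w) (12 * s - 2) := by
    fin_cases w
    · exact ⟨-1, 1, by simp [gap]⟩
    · have h2 : IsCoprime (2 * (s : ℤ) + 1) 2 := ⟨1, -s, by ring⟩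
      have h8 : IsCoprime (2 * (s : ℤ) + 1) (-2 ^ 3) := (h2.pow_right (n := 3)).neg_right
      change IsCoprime (2 * (s : ℤ) + 1) _
      rw [show (12 * (s : ℤ) - 2) = -2 ^ 3 + (2 * s + 1) * 6 by ring]
      exact h8.add_mul_left_right 6
    · exact ⟨-3, 1, by simp [gap]; ring⟩
  obtain ⟨a, b, hab⟩ := h
  exact ⟨a, by rw [cast_eq_cast hs b (b := 1) (by linarith), Int.cast_one]⟩

end

end RotationSystem

/-! ### Cyclicity of the rotations, and the site of the handle. -/

namespace RotationSystem

open SimpleGraph Equiv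

section

variable {s : ℕ} (hs : 2 ≤ s)

/-- The rotation at `q` in the triangular embedding of the complete graph minus a triangle. -/
noncomputable def rowPerm [NeZero (12 * s - 2)] (q : ZMod (12 * s - 2) ⊕ Fin 3) :
    Perm (ZMod (12 * s - 2) ⊕ Fin 3) :=
  Equiv.ofBijective (nextVertex s q)
    (Finite.injective_iff_bijective.1 (nextVertex_injective hs q))

theorem cycles_rowPerm_inl [NeZero (12 * s - 2)] (i : ZMod (12 * s - 2)) :
    (rowPerm hs (.inl i)).Cycles {.inl i}ᶜ := by
  set f := rowPerm hs (.inl i) with hf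
  have apply : ∀ p, f p = nextVertex s (.inl i) p := fun _ => rfl
  have gapStep : ∀ w, f (.inr w) = .inl (i + ((12 * s - 2 - gap s w : ℤ) : ZMod (12 * s - 2))) := by
    intro w
    rw [apply]
    change Sum.inl _ = _
    rw [cast_eq_cast hs (-1) (by ring : -gap s w - (12 * s - 2 - gap s w) = _), Int.cast_neg,
      sub_eq_add_neg]
  have gapStep' : ∀ w, f (.inl (i + (gap s w : ℤ))) = .inr w := fun w => nextVertex_gap hs i w
  -- The successor of x has difference -(12s-3) = 1, the start of the traversal.
  have one : f.SameCycle (.inr 0) (.inl (i + ((1 : ℤ) : ZMod (12 * s - 2)))) := by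
    refine ⟨1, ?_⟩
    rw [zpow_one, gapStep]
    congr 3
    simp [gap]
  have toGap : ∀ w, f.SameCycle (.inr 0) (.inl (i + (gap s w : ℤ))) → f.SameCycle (.inr 0) (.inr w) :=
    fun w h => h.trans ⟨1, by rw [zpow_one, gapStep']⟩
  have fromGap : ∀ w (d : ℤ), d = 12 * s - 2 - gap s w → f.SameCycle (.inr 0) (.inl (i + (gap s w : ℤ))) →
      f.SameCycle (.inr 0) (.inl (i + (d : ZMod (12 * s - 2)))) :=
    fun w d hd h => (toGap w h).trans ⟨1, by rw [zpow_one, gapStep, hd]⟩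
  have all : ∀ d : ℤ, 1 ≤ d → d < 12 * s - 2 →
      f.SameCycle (.inr 0) (.inl (i + (d : ZMod (12 * s - 2)))) := by
    refine nextDiff_induction (by omega) one (fun d h1 hd he h => h.trans ⟨1, ?_⟩)
      (fromGap 1 _ ?_) (fromGap 2 _ ?_)
    · rw [zpow_one, apply, nextVertex_of_nextDiff hs i h1 hd rfl he]
    · simp [gap]; ring
    · simp [gap]; ring
  have all' : ∀ p ∈ ({.inl i}ᶜ : Set (ZMod (12 * s - 2) ⊕ Fin 3)), f.SameCycle (.inr 0) p := by
    rintro (u | w) hp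
    · obtain ⟨d, h1, hd, rfl⟩ := exists_eq_add hs (fun e => hp (congrArg _ e) : u ≠ i)
      exact all d h1 hd
    · obtain ⟨h1, h2⟩ := gap_bounds hs w
      exact toGap w (all _ h1 h2)
  refine ⟨fun p hp => ?_, fun p hp => nextVertex_ne hs hp, fun p hp q hq =>
    (all' p hp).symm.trans (all' q hq)⟩
  rw [Set.mem_compl_iff, not_not] at hp
  rw [Set.mem_singleton_iff.1 hp, apply]
  exact nextVertex_self _

theorem cycles_rowPerm_inr [NeZero (12 * s - 2)] (w : Fin 3) :
    (rowPerm hs (.inr w)).Cycles {.inr 0, .inr 1, .inr 2}ᶜ := by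
  have hmem : ∀ p : ZMod (12 * s - 2) ⊕ Fin 3,
      p ∈ ({.inr 0, .inr 1, .inr 2}ᶜ : Set (ZMod (12 * s - 2) ⊕ Fin 3)) ↔ ∃ u, p = .inl u := by
    rintro (u | v)
    · simp
    · fin_cases v <;> simp
  have hadd : ∀ (u : ZMod (12 * s - 2)) (n : ℕ),
      (rowPerm hs (.inr w) ^ n) (.inl u) = .inl (u + n * (gap s w : ℤ)) := by
    intro u n
    induction n with
    | zero => simp
    | succ n ih =>
      rw [pow_succ', Perm.mul_apply, ih]
      change Sum.inl _ = Sum.inl _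
      push_cast
      congr 1
      ring
  refine ⟨fun p hp => ?_, fun p hp => ?_, fun p hp q hq => ?_⟩
  · rcases p with u | v
    · exact absurd ((hmem _).2 ⟨u, rfl⟩) hp
    · rfl
  · obtain ⟨u, rfl⟩ := (hmem p).1 hp
    exact (hmem _).2 ⟨_, rfl⟩
  · obtain ⟨u, rfl⟩ := (hmem p).1 hp
    obtain ⟨v, rfl⟩ := (hmem q).1 hq
    obtain ⟨k, hk⟩ := exists_mul_gap hs w
    refine ⟨((v - u) * k).val, ?_⟩
    rw [zpow_natCast, hadd, ZMod.natCast_zmod_val, mul_assoc, ← Int.cast_mul, hk]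
    congr 1
    ring

include hs in
-- Reduces a rotation entry between integer representatives to a value of `nextDiff`: d represents u
-- - i, and k and l count the multiples of 12s-2 dropped.
theorem nextVertex_cast {i u v : ℤ} (d k l : ℤ) (h1 : 1 ≤ d) (hd : d < 12 * s - 2)
    (hu : u - (i + d) = (12 * s - 2) * k) (he : nextDiff s d < 12 * s - 2)
    (hv : v - (i + nextDiff s d) = (12 * s - 2) * l) :
    nextVertex s (.inl i) (.inl u) = .inl (v : ZMod (12 * s - 2)) := by
  rw [← cast_eq_cast hs k hu, ← cast_eq_cast hs l hv, Int.cast_add, Int.cast_add]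
  exact nextVertex_of_nextDiff hs i h1 hd rfl he

include hs in
theorem nextVertex_cast_gap {i u : ℤ} {w : Fin 3} (k : ℤ)
    (hu : u - (i + gap s w) = (12 * s - 2) * k) :
    nextVertex s (.inl i) (.inl (u : ZMod (12 * s - 2))) = .inr w := by
  rw [← cast_eq_cast hs k hu, Int.cast_add]
  exact nextVertex_gap hs i w

include hs in
theorem nextVertex_gap_cast {u v : ℤ} {w : Fin 3} (k : ℤ)
    (hv : v - (u + gap s w) = (12 * s - 2) * k) :
    nextVertex s (.inr w) (.inl u) = .inl (v : ZMod (12 * s - 2)) := by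
  rw [← cast_eq_cast hs k hv, Int.cast_add]
  rfl

/-- The place where the handle is attached. -/
noncomputable def handleSite [NeZero (12 * s - 2)] : HandleSite (ZMod (12 * s - 2) ⊕ Fin 3) where
  σ := rowPerm hs
  o := .inl ((0 : ℤ) : ZMod (12 * s - 2))
  a := .inl ((2 * s - 2 : ℤ) : ZMod (12 * s - 2))
  b := .inl ((6 * s - 2 : ℤ) : ZMod (12 * s - 2))
  c := .inl ((10 * s - 3 : ℤ) : ZMod (12 * s - 2))
  d := .inl ((12 * s - 3 : ℤ) : ZMod (12 * s - 2))
  e := .inl ((8 * s - 1 : ℤ) : ZMod (12 * s - 2))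
  x := .inr 0
  y := .inr 1
  z := .inr 2
  nodup := by
    have h : ∀ d e : ℤ, 0 ≤ d → d < 12 * s - 2 → 0 ≤ e → e < 12 * s - 2 → d ≠ e →
        (d : ZMod (12 * s - 2)) ≠ e := by
      intro d e h1 h2 h3 h4 h5 h6
      rw [ZMod.intCast_eq_intCast_iff', Nat.cast_sub (by omega)] at h6
      push_cast at h6
      rw [Int.emod_eq_of_lt h1 h2, Int.emod_eq_of_lt h3 h4] at h6
      exact h5 h6
    simp only [List.nodup_cons, List.mem_cons, List.not_mem_nil, or_false, not_or,
      List.nodup_nil, and_true, not_false_eq_true, Sum.inl.injEq, Sum.inr.injEq, reduceCtorEq]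
    refine ⟨⟨?_, ?_, ?_, ?_, ?_⟩, ⟨?_, ?_, ?_, ?_⟩, ⟨?_, ?_, ?_⟩, ⟨?_, ?_⟩, ?_, ?_⟩
    all_goals first
      | exact h _ _ (by omega) (by omega) (by omega) (by omega) (by omega)
      | decide
  cycles := by
    rintro (i | w) h1 h2 h3
    · exact cycles_rowPerm_inl hs i
    · fin_cases w
      exacts [absurd rfl h1, absurd rfl h2, absurd rfl h3]
  cycles_x := cycles_rowPerm_inr hs 0
  cycles_y := cycles_rowPerm_inr hs 1
  cycles_z := cycles_rowPerm_inr hs 2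
  triangle := by
    intro p q hpq h
    have hr : ∀ p : ZMod (12 * s - 2) ⊕ Fin 3, p.isRight →
        p = .inr 0 ∨ p = .inr 1 ∨ p = .inr 2 := by
      rintro (u | w) h
      · simp at h
      · fin_cases w <;> simp
    exact nextVertex_nextVertex hs hpq fun h' => h ⟨hr p h'.1, hr q h'.2⟩
  z_b :=
    nextVertex_gap_cast hs 0 (by simp [gap]; ring)
  b_o :=
    nextVertex_cast hs (6 * s) (-1) (-1) (by omega) (by omega) (by ring)
      (by unfold nextDiff; omega) (by unfold nextDiff; omega)
  b_a :=
    nextVertex_cast hs (8 * s - 2) (-1) 0 (by omega) (by omega) (by ring)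
      (by unfold nextDiff; omega) (by unfold nextDiff; omega)
  z_c :=
    nextVertex_gap_cast hs (-1) (by simp [gap]; ring)
  x_o :=
    nextVertex_gap_cast hs 0 (by simp [gap])
  e_o :=
    nextVertex_cast_gap hs (-1) (by simp [gap]; ring)
  c_o :=
    nextVertex_cast_gap hs (-1) (by simp [gap]; ring)
  d_o :=
    nextVertex_cast hs 1 (-1) (-1) (by omega) (by omega) (by ring)
      (by unfold nextDiff; omega) (by unfold nextDiff; omega)

end

/-- Relabelling the vertices of a site for a handle. -/
def HandleSite.congr {V W : Type*} (H : HandleSite V) (f : V ≃ W) : HandleSite W where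
  σ w := f.permCongr (H.σ (f.symm w))
  o := f H.o
  a := f H.a
  b := f H.b
  c := f H.c
  d := f H.d
  e := f H.e
  x := f H.x
  y := f H.y
  z := f H.z
  nodup := H.nodup.map f.injective
  cycles w hx hy hz := by
    convert (H.cycles (f.symm w) (by rwa [Ne, f.symm_apply_eq]) (by rwa [Ne, f.symm_apply_eq])
      (by rwa [Ne, f.symm_apply_eq])).permCongr f using 1
    ext v
    simp
  cycles_x := by
    convert H.cycles_x.permCongr f using 1
    · simp
    · ext v; simp [f.symm_apply_eq]
  cycles_y := by
    convert H.cycles_y.permCongr f using 1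
    · simp
    · ext v; simp [f.symm_apply_eq]
  cycles_z := by
    convert H.cycles_z.permCongr f using 1
    · simp
    · ext v; simp [f.symm_apply_eq]
  triangle p q hpq h := by
    have := H.triangle (f.symm p) (f.symm q) (f.symm.injective.ne hpq)
      (by simpa only [f.symm_apply_eq] using h)
    simp [Equiv.permCongr_apply, this]
  z_b := by simp [Equiv.permCongr_apply, H.z_b]
  b_o := by simp [Equiv.permCongr_apply, H.b_o]
  b_a := by simp [Equiv.permCongr_apply, H.b_a]
  z_c := by simp [Equiv.permCongr_apply, H.z_c]
  x_o := by simp [Equiv.permCongr_apply, H.x_o]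
  e_o := by simp [Equiv.permCongr_apply, H.e_o]
  c_o := by simp [Equiv.permCongr_apply, H.c_o]
  d_o := by simp [Equiv.permCongr_apply, H.d_o]

end RotationSystem

theorem mainTheorem5 (s : ℕ) (hs : 2 ≤ s) :
    ∃ φ : RotationSystem (SimpleGraph.completeGraph (Fin (12 * s + 1))),
      φ.IsMinimumGenus ∧ φ.IsNearlyTriangular ∧
        ∃ f : φ.Face, φ.faceLength f = 6 ∧ ∀ f' : φ.Face, f' ≠ f → φ.faceLength f' = 3 := by
  have : NeZero (12 * s - 2) := ⟨by omega⟩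
  have hcard : Fintype.card (ZMod (12 * s - 2) ⊕ Fin 3) = Fintype.card (Fin (12 * s + 1)) := by
    rw [Fintype.card_sum, ZMod.card, Fintype.card_fin, Fintype.card_fin]
    omega
  obtain ⟨φ, f, hf, h⟩ :=
    ((RotationSystem.handleSite hs).congr (Fintype.equivOfCardEq hcard)).exists_hexagon
  refine ⟨φ, φ.isMinimumGenus_of_hexagon (by omega) (Fintype.card_fin _) f hf h, ?_, f, hf, h⟩
  intro g g' hg hg'
  by_cases e : g = f
  · by_cases e' : g' = f
    · rw [e, e']
    · exact absurd (h g' e') hg'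
  · exact absurd (h g e) hg
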